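/- Let $d\ge 2$ be an integer. For a discrete group $G$, a bounded function $\varphi:G\to\mathbb{C}$ is called an $M_d$-multiplier if there are complex Hilbert spaces $\mathcal{H}_0,\dots,\mathcal{H}_d$ with $\mathcal{H}_0=\mathcal{H}_d=\mathbb{C}$ and bounded maps $\xi_i:G\to\mathbf{B}(\mathcal{H}_i,\mathcal{H}_{i-1})$ ($1\le i\le d$) such that $$\varphi(t_1\cdots t_d)=\xi_1(t_1)\cdots\xi_d(t_d)1\qquad\text{for all }t_1,\dots,t_d\in G.$$ Let $M_d(G)$ be the space of these functions, with the norm $$\|\varphi\|_{M_d(G)}=\inf\Big\{\sup_{t\in G}\|\xi_1(t)\|\cdots\sup_{t\in G}\|\xi_d(t)\|\Big\},$$ the infimum being over all such decompositions of $\varphi$. Let $X_d(G)$ be the completion of $\ell^1(G)$ for the norm $$\|g\|_{X_d(G)}=\sup\Big\{\Big|\sum_{t\in G}\varphi(t)g(t)\Big| \;:\; \varphi\in M_d(G),\ \|\varphi\|_{M_d(G)}\le 1\Big\},$$ and extend the pairing $\langle\varphi,g\rangle=\sum_{t\in G}\varphi(t)g(t)$ by continuity to $M_d(G)\times X_d(G)$.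 The group $G$ has the $M_d$-AP if the constant function $1$ belongs to the closure of the set of finitely supported functions on $G$ in $M_d(G)$, with respect to the weak topology $\sigma(M_d(G),X_d(G))$ defined by this pairing. Let $G_1$ and $G_2$ be discrete groups which have the $M_d$-AP. Then the following groups have the $M_d$-AP as well: 1. the direct product $G_1\times G_2$; 2. the semidirect product $G_1\ltimes_\alpha G_2$, for every action $\alpha:G_1\to\operatorname{Aut}(G_2)$ by group automorphisms; 3. the free product $G_1*G_2$. -/

import Mathlib

open scoped Topology

universe u

namespace MdMult

/-- The product `ξ 0 (t 0) * ξ 1 (t 1) * ⋯ * ξ (n - 1) (t (n - 1)) : H n → H 0` of bounded operators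
`ξ i (s) : H (i + 1) → H i`. -/
noncomputable def opProd {G : Type u} {H : ℕ → Type u} [∀ i, NormedAddCommGroup (H i)]
    [∀ i, InnerProductSpace ℂ (H i)] (ξ : ∀ i, G → (H (i + 1) →L[ℂ] H i)) :
    ∀ n : ℕ, (Fin n → G) → (H n →L[ℂ] H 0)
  | 0, _ => ContinuousLinearMap.id ℂ (H 0)
  | n + 1, t => (opProd ξ n fun i => t i.castSucc).comp (ξ n (t (Fin.last n)))

/-- A decomposition `φ (t₁ ⋯ t_d) = ξ₁ (t₁) ⋯ ξ_d (t_d) 1` of `φ : G → ℂ`, where the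
`ξ_i : G → B(H_i, H_{i-1})` are bounded maps, the `H_i` are complex Hilbert spaces, and
`H_0 = H_d = ℂ`.

The map `ξ_{i+1}` above is `ξ i`. The identifications of `H 0` and `H d` with `ℂ` are the isometries
`e₀` and `e₁`. Only the `H i` with `i ≤ d` and the `ξ i` with `i < d` are relevant. -/
structure Decomposition {G : Type u} [Group G] (d : ℕ) (φ : G → ℂ) where
  H : ℕ → Type u
  [normed : ∀ i, NormedAddCommGroup (H i)]
  [inner : ∀ i, InnerProductSpace ℂ (H i)]
  [complete : ∀ i, CompleteSpace (H i)]
  ξ : ∀ i, G → (H (i + 1) →L[ℂ] H i)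
  e₀ : H 0 ≃ₗᵢ[ℂ] ℂ
  e₁ : H d ≃ₗᵢ[ℂ] ℂ
  bounded : ∀ i < d, BddAbove (Set.range fun t => ‖ξ i t‖)
  eq : ∀ t : Fin d → G, φ (List.ofFn t).prod = e₀ (opProd ξ d t (e₁.symm 1))

attribute [instance] Decomposition.normed Decomposition.inner Decomposition.complete

variable {G : Type u} [Group G] {d : ℕ}

/-- The number `sup_t ‖ξ₁ (t)‖ ⋯ sup_t ‖ξ_d (t)‖`. -/
noncomputable def Decomposition.cost {φ : G → ℂ} (D : Decomposition d φ) : ℝ :=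
  ∏ i ∈ Finset.range d, ⨆ t : G, ‖D.ξ i t‖

/-- `φ` is an `M_d`-multiplier of the discrete group `G`. -/
structure IsMultiplier (d : ℕ) (φ : G → ℂ) : Prop where
  bounded : ∃ C : ℝ, ∀ t, ‖φ t‖ ≤ C
  decomposable : Nonempty (Decomposition d φ)

/-- The norm of `M_d(G)`, the infimum of the costs of all decompositions. -/
noncomputable def mdNorm (d : ℕ) (φ : G → ℂ) : ℝ :=
  ⨅ D : Decomposition d φ, D.cost

variable (G d) in
/-- The space `M_d(G)` of `M_d`-multipliers. -/
def Md : Type u := {φ : G → ℂ // IsMultiplier d φ}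

/-- The space `L¹(G) = ℓ¹(G)` of the discrete group `G` (with the counting measure). -/
abbrev Ell1 (G : Type u) : Type u := lp (fun _ : G => ℂ) 1

theorem summable_pairing {G : Type u} {φ : G → ℂ} (hφ : ∃ C : ℝ, ∀ t, ‖φ t‖ ≤ C) (g : Ell1 G) :
    Summable fun t => φ t * g t := by
  obtain ⟨C, hC⟩ := hφ
  have hg : Summable fun t => ‖g t‖ := by
    simpa using (lp.memℓp g).summable (by norm_num)
  refine Summable.of_norm_bounded (hg.mul_left C) fun t => ?_
  rw [norm_mul]
  exact mul_le_mul_of_nonneg_right (hC t) (norm_nonneg _)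

/-- The duality `⟨φ, g⟩ = ∑ φ (t) g (t)` between `M_d(G)` and `L¹(G)`. -/
noncomputable def pairing (φ : Md G d) : Ell1 G →ₗ[ℂ] ℂ where
  toFun g := ∑' t, φ.1 t * g t
  map_add' f g := by
    rw [← (summable_pairing φ.2.bounded f).tsum_add (summable_pairing φ.2.bounded g)]
    exact tsum_congr fun t => by simp [mul_add]
  map_smul' c g := by
    simp only [RingHom.id_apply, smul_eq_mul]
    rw [← tsum_mul_left]
    exact tsum_congr fun t => by simp [mul_left_comm]

variable (G d) in
/-- The norm of `X_d(G)` on `L¹(G)`: the supremum of `|⟨φ, g⟩|` over the unit ball of `M_d(G)`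
(see `xdSeminorm_apply`). -/
noncomputable def xdSeminorm : Seminorm ℂ (Ell1 G) :=
  ⨆ φ : {φ : Md G d // mdNorm d φ.1 ≤ 1}, (normSeminorm ℂ ℂ).comp (pairing φ.1)

/-- A copy of `L¹(G)`, which carries the norm of `X_d(G)`. -/
@[nolint unusedArguments]
def PreXd (G : Type u) [Group G] (_d : ℕ) : Type u := Ell1 G

noncomputable instance : AddCommGroup (PreXd G d) := inferInstanceAs (AddCommGroup (Ell1 G))

variable (G d) in
/-- The identity map from `PreXd G d` to `L¹(G)`. -/
noncomputable def toEll1 : PreXd G d ≃+ Ell1 G := AddEquiv.refl (Ell1 G)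

noncomputable instance : SeminormedAddCommGroup (PreXd G d) :=
  AddGroupSeminorm.toSeminormedAddCommGroup
    (E := PreXd G d) (xdSeminorm G d).toAddGroupSeminorm

variable (G d) in
/-- `X_d(G)`, the completion of `L¹(G)` for the norm `xdSeminorm`. -/
abbrev Xd : Type u := UniformSpace.Completion (PreXd G d)

/-- The duality `⟨φ, x⟩` between `M_d(G)` and `X_d(G)`: the continuous extension of `pairing φ`
(see `uniformContinuous_pairing`). -/
noncomputable def xdPairing (φ : Md G d) : Xd G d → ℂ :=
  UniformSpace.Completion.extension fun g : PreXd G d => pairing φ (toEll1 G d g)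

variable (G d) in
/-- The topology `σ(M_d(G), X_d(G))`: the coarsest one for which all the maps `φ ↦ ⟨φ, x⟩`,
`x ∈ X_d(G)`, are continuous. -/
@[reducible]
noncomputable def weakStar : TopologicalSpace (Md G d) :=
  ⨅ x : Xd G d, TopologicalSpace.induced (fun φ : Md G d => xdPairing φ x) inferInstance

variable (G d) in
/-- The constant function `1` is an `M_d`-multiplier. -/
theorem isMultiplier_one : IsMultiplier d (fun _ : G => (1 : ℂ)) where
  bounded := ⟨1, fun _ => by simp⟩
  decomposable := by
    let e : EuclideanSpace ℂ PUnit.{u + 1} ≃ₗᵢ[ℂ] ℂ :=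
      (EuclideanSpace.basisFun PUnit.{u + 1} ℂ).equiv
        (OrthonormalBasis.singleton PUnit.{u + 1} ℂ) (Equiv.refl _)
    refine ⟨{ H := fun _ => EuclideanSpace ℂ PUnit.{u + 1}
              ξ := fun _ _ => ContinuousLinearMap.id ℂ _
              e₀ := e
              e₁ := e
              bounded := fun i _ => ⟨‖ContinuousLinearMap.id ℂ (EuclideanSpace ℂ PUnit.{u + 1})‖, by
                rintro _ ⟨t, rfl⟩; exact le_rfl⟩
              eq := fun t => ?_ }⟩
    have h : ∀ (n : ℕ) (t : Fin n → G), opProd (H := fun _ => EuclideanSpace ℂ PUnit.{u + 1})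
        (fun _ _ => ContinuousLinearMap.id ℂ _) n t = ContinuousLinearMap.id ℂ _ := by
      intro n
      induction n with
      | zero => intro t; rfl
      | succ n ih => intro t; rw [opProd, ih]; rfl
    rw [h]
    simp

variable (G d) in
/-- The constant function `1` as an element of `M_d(G)`. -/
def Md.one : Md G d := ⟨fun _ => 1, isMultiplier_one G d⟩

variable (G d) in
/-- `C_c(G)` as a subset of `M_d(G)`, for discrete `G`: the finitely supported functions. -/
def Cc : Set (Md G d) := {φ | (Function.support φ.1).Finite}

variable (G d) in
/-- The `M_d`-approximation property of the discrete group `G`: the constant function `1` belongs to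
the `σ(M_d(G), X_d(G))`-closure of `C_c(G)` in `M_d(G)`. -/
def HasMdAP : Prop :=
  Md.one G d ∈ closure[weakStar G d] (Cc G d)

/-! Facts which show that the definitions above are meaningful for `d ≥ 1`: the suprema are
finite, and `⟨φ, ·⟩` is continuous for the norm of `X_d(G)`. -/

theorem Decomposition.cost_nonneg {φ : G → ℂ} (D : Decomposition d φ) : 0 ≤ D.cost :=
  Finset.prod_nonneg fun _ _ => Real.iSup_nonneg fun _ => norm_nonneg _

theorem mdNorm_nonneg (φ : G → ℂ) : 0 ≤ mdNorm d φ :=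
  Real.iInf_nonneg fun D => D.cost_nonneg

theorem norm_opProd_le {φ : G → ℂ} (D : Decomposition d φ) (n : ℕ) (hn : n ≤ d) (t : Fin n → G) :
    ‖opProd D.ξ n t‖ ≤ ∏ i ∈ Finset.range n, ⨆ s : G, ‖D.ξ i s‖ := by
  induction n with
  | zero => simpa [opProd] using ContinuousLinearMap.norm_id_le
  | succ n ih =>
    rw [opProd, Finset.prod_range_succ]
    refine (ContinuousLinearMap.opNorm_comp_le _ _).trans ?_
    exact mul_le_mul (ih (by omega) _) (le_ciSup (D.bounded n (by omega)) _) (norm_nonneg _)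
      (Finset.prod_nonneg fun _ _ => Real.iSup_nonneg fun _ => norm_nonneg _)

theorem Decomposition.norm_le_cost {φ : G → ℂ} (D : Decomposition d φ) (hd : d ≠ 0) (s : G) :
    ‖φ s‖ ≤ D.cost := by
  obtain ⟨n, rfl⟩ := Nat.exists_eq_succ_of_ne_zero hd
  have h := D.eq (Fin.cons s fun _ => 1)
  have hp : (List.ofFn (Fin.cons s fun _ => 1 : Fin (n + 1) → G)).prod = s := by
    simp [List.ofFn_succ]
  rw [hp] at h
  have h1 : ‖D.e₁.symm 1‖ = 1 := by rw [D.e₁.symm.norm_map, norm_one]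
  rw [h, D.e₀.norm_map]
  refine ((opProd D.ξ (n + 1) _).le_opNorm (D.e₁.symm 1)).trans ?_
  rw [h1, mul_one]
  exact norm_opProd_le D _ le_rfl _

theorem norm_le_mdNorm (hd : d ≠ 0) (φ : Md G d) (s : G) : ‖φ.1 s‖ ≤ mdNorm d φ.1 :=
  have := φ.2.decomposable
  le_ciInf fun D => D.norm_le_cost hd s

theorem bddAbove_pairing (hd : d ≠ 0) :
    BddAbove (Set.range fun φ : {φ : Md G d // mdNorm d φ.1 ≤ 1} =>
      (normSeminorm ℂ ℂ).comp (pairing φ.1)) := by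
  rw [Seminorm.bddAbove_range_iff]
  intro g
  have hg : Summable fun t => ‖g t‖ := by
    simpa using (lp.memℓp g).summable (by norm_num)
  refine ⟨∑' t, ‖g t‖, ?_⟩
  rintro _ ⟨φ, rfl⟩
  change ‖∑' t, φ.1.1 t * g t‖ ≤ _
  refine tsum_of_norm_bounded hg.hasSum fun t => ?_
  rw [norm_mul]
  exact mul_le_of_le_one_left (norm_nonneg _) ((norm_le_mdNorm hd φ.1 t).trans φ.2)

theorem xdSeminorm_apply (hd : d ≠ 0) (g : Ell1 G) :
    xdSeminorm G d g = ⨆ φ : {φ : Md G d // mdNorm d φ.1 ≤ 1}, ‖∑' t, φ.1.1 t * g t‖ :=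
  Seminorm.iSup_apply (bddAbove_pairing hd)

theorem opProd_update {G : Type u} {H : ℕ → Type u} [∀ i, NormedAddCommGroup (H i)]
    [∀ i, InnerProductSpace ℂ (H i)] (ξ : ∀ i, G → (H (i + 1) →L[ℂ] H i)) (c : ℂ) (n : ℕ)
    (t : Fin (n + 1) → G) :
    opProd (fun i s => (if i = 0 then c else 1) • ξ i s) (n + 1) t = c • opProd ξ (n + 1) t := by
  induction n with
  | zero => ext x; simp [opProd]
  | succ n ih => rw [opProd, ih]; ext x; simp [opProd]

/-- Multiply `φ` and `ξ₁` by a scalar. -/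
def Decomposition.smul {φ : G → ℂ} (D : Decomposition d φ) (hd : d ≠ 0) (c : ℂ) :
    Decomposition d (fun s => c * φ s) where
  H := D.H
  ξ i s := (if i = 0 then c else 1) • D.ξ i s
  e₀ := D.e₀
  e₁ := D.e₁
  bounded i hi := by
    obtain ⟨C, hC⟩ := D.bounded i hi
    refine ⟨‖(if i = 0 then c else 1 : ℂ)‖ * C, ?_⟩
    rintro _ ⟨t, rfl⟩
    change ‖(if i = 0 then c else 1 : ℂ) • D.ξ i t‖ ≤ _
    rw [norm_smul]
    exact mul_le_mul_of_nonneg_left (hC ⟨t, rfl⟩) (norm_nonneg _)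
  eq t := by
    obtain ⟨n, rfl⟩ := Nat.exists_eq_succ_of_ne_zero hd
    rw [opProd_update, D.eq]
    simp

theorem Decomposition.cost_smul {φ : G → ℂ} (D : Decomposition d φ) (hd : d ≠ 0) (c : ℂ) :
    (D.smul hd c).cost = ‖c‖ * D.cost := by
  obtain ⟨n, rfl⟩ := Nat.exists_eq_succ_of_ne_zero hd
  have h (i : ℕ) : ⨆ t : G, ‖(D.smul hd c).ξ i t‖ =
      ‖(if i = 0 then c else 1 : ℂ)‖ * ⨆ t : G, ‖D.ξ i t‖ := by
    rw [Real.mul_iSup_of_nonneg (norm_nonneg _)]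
    exact congrArg iSup (funext fun t => norm_smul (if i = 0 then c else 1 : ℂ) (D.ξ i t))
  unfold cost
  simp only [h, Finset.prod_range_succ']
  simp
  ring

theorem norm_pairing_le (hd : d ≠ 0) (φ : Md G d) (g : Ell1 G) :
    ‖pairing φ g‖ ≤ mdNorm d φ.1 * xdSeminorm G d g := by
  have key : ∀ C : ℝ, mdNorm d φ.1 < C → ‖pairing φ g‖ ≤ C * xdSeminorm G d g := by
    intro C hC
    have hC0 : 0 < C := (mdNorm_nonneg φ.1).trans_lt hC
    have := φ.2.decomposable
    obtain ⟨D, hD⟩ := exists_lt_of_ciInf_lt hC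
    obtain ⟨B, hB⟩ := φ.2.bounded
    let ψ : Md G d := ⟨fun s => (C⁻¹ : ℂ) * φ.1 s, ⟨‖(C⁻¹ : ℂ)‖ * B, fun t => by
      rw [norm_mul]; exact mul_le_mul_of_nonneg_left (hB t) (norm_nonneg _)⟩,
      ⟨D.smul hd (C⁻¹ : ℂ)⟩⟩
    have hψ : mdNorm d ψ.1 ≤ 1 := by
      refine (ciInf_le ⟨0, ?_⟩ (D.smul hd (C⁻¹ : ℂ))).trans ?_
      · rintro _ ⟨E, rfl⟩; exact E.cost_nonneg
      · rw [D.cost_smul, norm_inv, Complex.norm_real, Real.norm_of_nonneg hC0.le,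
          inv_mul_le_one₀ hC0]
        exact hD.le
    have h1 : ‖pairing ψ g‖ ≤ xdSeminorm G d g := by
      have := le_ciSup (Seminorm.bddAbove_range_iff.1 (bddAbove_pairing (G := G) hd) g) ⟨ψ, hψ⟩
      rw [← Seminorm.iSup_apply (bddAbove_pairing hd)] at this
      exact this
    have h2 : pairing ψ g = (C⁻¹ : ℂ) * pairing φ g := by
      change ∑' t, (C⁻¹ : ℂ) * φ.1 t * g t = (C⁻¹ : ℂ) * ∑' t, φ.1 t * g t
      rw [← tsum_mul_left]
      exact tsum_congr fun t => mul_assoc _ _ _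
    rw [h2, norm_mul, norm_inv, Complex.norm_real, Real.norm_of_nonneg hC0.le,
      inv_mul_le_iff₀ hC0] at h1
    exact h1
  have hlim : Filter.Tendsto (fun C : ℝ => C * xdSeminorm G d g) (𝓝[>] (mdNorm d φ.1))
      (𝓝 (mdNorm d φ.1 * xdSeminorm G d g)) :=
    ((continuous_id.mul continuous_const).tendsto _).mono_left nhdsWithin_le_nhds
  exact ge_of_tendsto hlim (Filter.eventually_of_mem self_mem_nhdsWithin key)

theorem uniformContinuous_pairing (hd : d ≠ 0) (φ : Md G d) :
    UniformContinuous fun g : PreXd G d => pairing φ (toEll1 G d g) := by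
  refine (LipschitzWith.of_dist_le_mul (K := ⟨mdNorm d φ.1, mdNorm_nonneg _⟩)
    fun f g => ?_).uniformContinuous
  rw [dist_eq_norm, dist_eq_norm, ← map_sub (pairing φ), ← map_sub (toEll1 G d)]
  exact norm_pairing_le hd φ _

theorem xdPairing_coe (hd : d ≠ 0) (φ : Md G d) (g : PreXd G d) :
    xdPairing φ (g : Xd G d) = ∑' t, φ.1 t * toEll1 G d g t :=
  UniformSpace.Completion.extension_coe (uniformContinuous_pairing hd φ) g

end MdMult

/-! The argument runs by duality: a group has the `M_d`-AP iff every `x` in `X_d` that annihilates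
all point masses also annihilates `1` (`hasMdAP_iff`). Such an `x` can be transported. If a partial
map `G → G'` pulls multipliers back contractively, summation over its fibres extends to a map
`X_d(G) → X_d(G')` (`exists_predual`). This applies to homomorphisms, and to the identification of a
coset of a subgroup `N` with `N`, because decompositions over `N` can be induced to `G` on Hilbert
sums over the cosets (`CosetSection.exists_decomposition_extendCoset`).

Products and semidirect products are extensions of `Q` by `N`. If `x` kills the point masses of `G`,
the property of `N` shows that `x` kills the indicators of the cosets of `N`. These are the
pullbacks of the point masses of `Q`, so the image of `x` in `X_d(Q)` kills the point masses, hence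
kills `1`.

The free product embeds into the semidirect product of `G₁ × G₂` with the free group on the set `G₁
× G₂` (`exists_coprod_embedding`), and the property passes to subgroups. Only free groups remain,
and a directed union reduces them to finite rank. There `r ^ |x|` is positive definite, of
multiplier norm at most `1`, and tends to `1` as `r → 1`. For complex `z` with `|z| = r < 1`, `z ^
|x|` is a coefficient of a uniformly bounded representation, with a bound independent of the
argument of `z`. Fourier coefficients in that argument then control each sphere, so the truncations
of `r ^ |x|` to balls converge as functionals on `X_d`, and an `x` killing point masses kills `r ^
|x|` (`hasMdAP_of_length`). -/

namespace MdMult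

/-! ### Constructing decompositions from vectors and operators -/

section Decompositions

variable {G : Type u} [Group G] {d : ℕ}

/-- At the intermediate indices the projections are the identity, so only the two ends of the
product are compressed. -/
theorem opProd_compression {G : Type u} {K : ℕ → Type u} [∀ i, NormedAddCommGroup (K i)]
    [∀ i, InnerProductSpace ℂ (K i)] (η : ∀ i, G → (K (i + 1) →L[ℂ] K i))
    (S : ∀ i, Submodule ℂ (K i)) [∀ i, (S i).HasOrthogonalProjection]
    (n : ℕ) (hS : ∀ i, 0 < i → i < n + 1 → S i = ⊤) (t : Fin (n + 1) → G) (u : S (n + 1)) :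
    opProd (H := fun i => S i)
        (fun i s => (S i).orthogonalProjectionOnto ∘L η i s ∘L (S (i + 1)).subtypeL) (n + 1) t u =
      (S 0).orthogonalProjectionOnto (opProd η (n + 1) t u) := by
  induction n with
  | zero => rfl
  | succ n ih =>
    have hsucc : opProd η (n + 1 + 1) t u =
        opProd η (n + 1) (fun i => t i.castSucc) (η (n + 1) (t (Fin.last (n + 1))) u) := rfl
    rw [opProd, ContinuousLinearMap.comp_apply, ih fun i h h' => hS i h (by omega), hsucc]
    simp only [ContinuousLinearMap.comp_apply, Submodule.subtypeL_apply]
    congr 2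
    have h : η (n + 1) (t (Fin.last (n + 1))) u ∈ S (n + 1) := by
      rw [hS _ (by omega) (by omega)]; trivial
    exact congrArg Subtype.val (Submodule.orthogonalProjectionOnto_mem_subspace_eq_self ⟨_, h⟩)

theorem exists_decomposition_of_norm_eq_one {K : ℕ → Type u} [∀ i, NormedAddCommGroup (K i)]
    [∀ i, InnerProductSpace ℂ (K i)] [∀ i, CompleteSpace (K i)] (hd : d ≠ 0)
    (η : ∀ i, G → (K (i + 1) →L[ℂ] K i)) (c : ℕ → ℝ) (hη : ∀ i < d, ∀ t, ‖η i t‖ ≤ c i)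
    (w : K 0) (v : K d) (hw : ‖w‖ = 1) (hv : ‖v‖ = 1) (φ : G → ℂ)
    (hφ : ∀ t : Fin d → G, φ (List.ofFn t).prod = inner ℂ w (opProd η d t v)) :
    ∃ D : Decomposition d φ, D.cost ≤ ∏ i ∈ Finset.range d, c i := by
  classical
  -- Only the end spaces are cut down, to the lines of `w` and `v`; `d ≠ 0` keeps the two updates
  -- apart. The projections are contractive, so the bounds survive.
  let S : ∀ i, Submodule ℂ (K i) :=
    Function.update (Function.update (fun i => (⊤ : Submodule ℂ (K i))) 0 (ℂ ∙ w)) d (ℂ ∙ v)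
  have hS0 : S 0 = ℂ ∙ w := by
    simp only [S]; rw [Function.update_of_ne hd.symm, Function.update_self]
  have hSd : S d = ℂ ∙ v := Function.update_self ..
  have hS : ∀ i, i ≠ 0 → i ≠ d → S i = ⊤ := fun i h h' => by
    simp only [S]; rw [Function.update_of_ne h', Function.update_of_ne h]
  have hcomp : ∀ i, CompleteSpace (S i) := fun i => by
    by_cases h : i = d
    · subst h; rw [hSd]; infer_instance
    by_cases h' : i = 0
    · subst h'; rw [hS0]; infer_instance
    rw [hS i h' h]; exact isClosed_univ.completeSpace_coe
  let ξ : ∀ i, G → (S (i + 1) →L[ℂ] S i) :=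
    fun i s => (S i).orthogonalProjectionOnto ∘L η i s ∘L (S (i + 1)).subtypeL
  have hξ : ∀ i < d, ∀ t, ‖ξ i t‖ ≤ c i := fun i hi t => by
    refine ContinuousLinearMap.opNorm_le_bound _ ((norm_nonneg _).trans (hη i hi t)) fun y => ?_
    refine ((S i).norm_orthogonalProjectionOnto_apply_le _).trans ?_
    exact ((η i t).le_opNorm _).trans
      (mul_le_mul_of_nonneg_right (hη i hi t) (norm_nonneg _))
  let e₀ : S 0 ≃ₗᵢ[ℂ] ℂ :=
    (LinearIsometryEquiv.ofEq _ _ hS0).trans (LinearIsometryEquiv.toSpanUnitSingleton w hw).symm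
  let e₁ : S d ≃ₗᵢ[ℂ] ℂ :=
    (LinearIsometryEquiv.ofEq _ _ hSd).trans (LinearIsometryEquiv.toSpanUnitSingleton v hv).symm
  have he₀ : ∀ y : K 0, e₀ ((S 0).orthogonalProjectionOnto y) = inner ℂ w y := fun y => by
    rw [← e₀.symm.injective.eq_iff, e₀.symm_apply_apply]
    apply Subtype.ext
    have h1 : ((e₀.symm (inner ℂ w y) : S 0) : K 0) = (inner ℂ w y : ℂ) • w := by
      simp [e₀]
    rw [h1, ← Submodule.starProjection_unit_singleton ℂ hw, Submodule.starProjection_apply]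
    congr!
  have he₁ : ((e₁.symm 1 : S d) : K d) = v := by simp [e₁]
  refine ⟨{ H := fun i => S i, ξ := ξ, e₀ := e₀, e₁ := e₁, bounded := ?_, eq := ?_ }, ?_⟩
  · rintro i hi
    exact ⟨c i, by rintro _ ⟨t, rfl⟩; exact hξ i hi t⟩
  · intro t
    obtain ⟨n, rfl⟩ := Nat.exists_eq_succ_of_ne_zero hd
    rw [hφ, opProd_compression η S n (fun i h h' => hS i h.ne' h'.ne) t, he₀, he₁]
  · refine Finset.prod_le_prod (fun i _ => Real.iSup_nonneg fun t => norm_nonneg _) fun i hi => ?_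
    exact ciSup_le fun t => hξ i (Finset.mem_range.1 hi) t

theorem exists_decomposition_zero (hd : d ≠ 0) :
    ∃ D : Decomposition d (fun _ : G => (0 : ℂ)), D.cost ≤ 0 := by
  obtain ⟨D⟩ := (isMultiplier_one G d).decomposable
  have h := D.cost_smul hd 0
  have key : ∀ (φ : G → ℂ) (E : Decomposition d φ), φ = (fun _ => 0) → E.cost = 0 →
      ∃ D : Decomposition d (fun _ : G => (0 : ℂ)), D.cost ≤ 0 := by
    rintro φ E rfl hE
    exact ⟨E, hE.le⟩
  exact key _ (D.smul hd 0) (by simp) (by rw [h]; simp)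

/-- The end spaces of a decomposition may be arbitrary Hilbert spaces. -/
theorem exists_decomposition {K : ℕ → Type u} [∀ i, NormedAddCommGroup (K i)]
    [∀ i, InnerProductSpace ℂ (K i)] [∀ i, CompleteSpace (K i)] (hd : d ≠ 0)
    (η : ∀ i, G → (K (i + 1) →L[ℂ] K i)) (c : ℕ → ℝ) (hη : ∀ i < d, ∀ t, ‖η i t‖ ≤ c i)
    (w : K 0) (v : K d) (φ : G → ℂ)
    (hφ : ∀ t : Fin d → G, φ (List.ofFn t).prod = inner ℂ w (opProd η d t v)) :
    ∃ D : Decomposition d φ, D.cost ≤ ‖w‖ * ‖v‖ * ∏ i ∈ Finset.range d, c i := by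
  have hsurj : ∀ s : G, ∃ t : Fin d → G, (List.ofFn t).prod = s := fun s => by
    obtain ⟨n, rfl⟩ := Nat.exists_eq_succ_of_ne_zero hd
    exact ⟨Fin.cons s fun _ => 1, by simp [List.ofFn_succ]⟩
  -- A zero end vector cannot be normalised, but then `φ` vanishes since every element is a product
  -- of `d` elements.
  by_cases h0 : w = 0 ∨ v = 0
  · have hφ0 : φ = fun _ => 0 := by
      funext s
      obtain ⟨t, rfl⟩ := hsurj s
      rw [hφ]
      rcases h0 with rfl | rfl <;> simp
    subst hφ0
    obtain ⟨D, hD⟩ := exists_decomposition_zero (G := G) hd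
    refine ⟨D, hD.trans ?_⟩
    rcases h0 with rfl | rfl <;> simp
  push Not at h0
  obtain ⟨hw, hv⟩ := h0
  have hw' : (‖w‖ : ℂ) ≠ 0 := by exact_mod_cast norm_ne_zero_iff.2 hw
  have hv' : (‖v‖ : ℂ) ≠ 0 := by exact_mod_cast norm_ne_zero_iff.2 hv
  obtain ⟨D, hD⟩ := exists_decomposition_of_norm_eq_one hd η c hη ((‖w‖⁻¹ : ℂ) • w)
    ((‖v‖⁻¹ : ℂ) • v) (norm_smul_inv_norm hw) (norm_smul_inv_norm hv)
    (fun s => (‖w‖⁻¹ * ‖v‖⁻¹ : ℂ) * φ s) (fun t => by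
      rw [hφ, map_smul, inner_smul_left, inner_smul_right]; simp [mul_assoc])
  have h : φ = fun s => (‖w‖ * ‖v‖ : ℂ) * ((‖w‖⁻¹ * ‖v‖⁻¹ : ℂ) * φ s) := by
    funext s; push_cast; field_simp
  rw [h]
  refine ⟨D.smul hd _, ?_⟩
  rw [D.cost_smul hd]
  simp only [norm_mul, Complex.norm_real, norm_norm]
  gcongr

/-- A cocycle-type criterion: if the translations of `v` are uniformly bounded on the span of `v`,
then the coefficients `⟨w, v (s)⟩` are multipliers. -/
theorem exists_decomposition_of_bounded_translation {E : Type u} [NormedAddCommGroup E]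
    [InnerProductSpace ℂ E] [CompleteSpace E] (hd : d ≠ 0) (v : G → E) (w : E) (C : ℝ)
    (hC : 0 ≤ C)
    (hv : ∀ (g : G) (f : G →₀ ℂ),
      ‖f.sum fun x a => a • v (g * x)‖ ≤ C * ‖f.sum fun x a => a • v x‖) :
    ∃ D : Decomposition d (fun s => inner ℂ w (v s)), D.cost ≤ ‖w‖ * ‖v 1‖ * C ^ d := by
  let A : (G →₀ ℂ) →ₗ[ℂ] E := Finsupp.linearCombination ℂ v
  let K : Submodule ℂ E := (LinearMap.range A).topologicalClosure
  have : CompleteSpace K := (Submodule.isClosed_topologicalClosure _).completeSpace_coe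
  let e : (G →₀ ℂ) →ₗ[ℂ] K := A.codRestrict K fun f =>
    Submodule.le_topologicalClosure _ (LinearMap.mem_range_self A f)
  have he : DenseRange e := by
    intro y
    have hy : (y : E) ∈ closure (Set.range A) := y.2
    rw [Topology.IsInducing.subtypeVal.closure_eq_preimage_closure_image]
    have : Subtype.val '' Set.range e = Set.range A := by
      rw [← Set.range_comp]; rfl
    rw [Set.mem_preimage]
    convert hy
    exact this
  let τ : G → (G →₀ ℂ) →ₗ[ℂ] (G →₀ ℂ) := fun g => Finsupp.lmapDomain ℂ ℂ (g * ·)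
  have hτ : ∀ g f, ‖(e ∘ₗ τ g) f‖ ≤ C * ‖e f‖ := fun g f => by
    have h := hv g f
    have h1 : A (τ g f) = f.sum fun x a => a • v (g * x) := by
      simp only [A, τ, Finsupp.lmapDomain_apply, Finsupp.linearCombination_mapDomain]
      rfl
    change ‖A (τ g f)‖ ≤ C * ‖A f‖
    rw [h1]; exact h
  -- The hypothesis makes `v x ↦ v (g * x)` well defined and bounded on the span, hence on its
  -- closure `K`. The same representation `π` serves for all `d` factors, whence `C ^ d`.
  let π : G → (K →L[ℂ] K) := fun g => (e ∘ₗ τ g).extendOfNorm e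
  have hπ : ∀ g f, π g (e f) = e (τ g f) := fun g f =>
    LinearMap.extendOfNorm_eq he ⟨C, hτ g⟩ f
  have hπn : ∀ g, ‖π g‖ ≤ C := fun g => LinearMap.opNorm_extendOfNorm_le he hC (hτ g)
  let x : G → K := fun g => e (Finsupp.single g 1)
  have hx : ∀ g, (x g : E) = v g := fun g => by simp [x, e, A]
  have hπx : ∀ g h, π g (x h) = x (g * h) := fun g h => by
    simp only [x, hπ]; simp [τ]
  have hprod : ∀ (n : ℕ) (t : Fin n → G) (h : G),
      opProd (H := fun _ => K) (fun _ => π) n t (x h) = x ((List.ofFn t).prod * h) := by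
    intro n
    induction n with
    | zero => intro t h; simp [opProd]
    | succ n ih =>
      intro t h
      rw [opProd, ContinuousLinearMap.comp_apply, hπx, ih, List.ofFn_succ']
      simp [mul_assoc]
  have hw : ∀ y : K, inner ℂ (K.orthogonalProjectionOnto w) y = inner ℂ w (y : E) := fun y => by
    simp
  obtain ⟨D, hD⟩ := exists_decomposition hd (K := fun _ => K) (fun _ => π) (fun _ => C)
    (fun _ _ => hπn) (K.orthogonalProjectionOnto w) (x 1) (fun s => inner ℂ w (v s))
    (fun t => by rw [hprod, hw, hx, mul_one])
  refine ⟨D, hD.trans ?_⟩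
  rw [Finset.prod_const, Finset.card_range]
  have h1 : ‖x 1‖ = ‖v 1‖ := by rw [← hx]; rfl
  rw [h1]
  have := K.norm_orthogonalProjectionOnto_apply_le w
  gcongr

/-- The norm of a linear combination depends only on the Gram matrix of the vectors. -/
theorem norm_sum_smul_translate_eq {E : Type u} [NormedAddCommGroup E]
    [InnerProductSpace ℂ E] (v : G → E)
    (hv : ∀ g x y, (inner ℂ (v (g * x)) (v (g * y)) : ℂ) = inner ℂ (v x) (v y))
    (g : G) (s : Finset G) (a : G → ℂ) :
    ‖∑ x ∈ s, a x • v (g * x)‖ = ‖∑ x ∈ s, a x • v x‖ := by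
  have h : (inner ℂ (∑ x ∈ s, a x • v (g * x)) (∑ x ∈ s, a x • v (g * x)) : ℂ) =
      inner ℂ (∑ x ∈ s, a x • v x) (∑ x ∈ s, a x • v x) := by
    simp only [sum_inner, inner_sum, inner_smul_left, inner_smul_right, hv]
  rw [@norm_eq_sqrt_re_inner ℂ, h, ← @norm_eq_sqrt_re_inner ℂ]

theorem exists_decomposition_of_invariant {E : Type u} [NormedAddCommGroup E]
    [InnerProductSpace ℂ E] [CompleteSpace E] (hd : d ≠ 0) (v : G → E) (w : E)
    (hv : ∀ g x y, (inner ℂ (v (g * x)) (v (g * y)) : ℂ) = inner ℂ (v x) (v y)) :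
    ∃ D : Decomposition d (fun s => inner ℂ w (v s)), D.cost ≤ ‖w‖ * ‖v 1‖ := by
  simpa using exists_decomposition_of_bounded_translation hd v w 1 zero_le_one fun g f => by
    rw [Finsupp.sum, norm_sum_smul_translate_eq v hv, one_mul, Finsupp.sum]

end Decompositions

/-! ### Weighted partial permutations of Hilbert sums -/

section BlockOperators

variable {I J E F : Type*} [NormedAddCommGroup E] [NormedSpace ℂ E] [NormedAddCommGroup F]
  [NormedSpace ℂ F]

/-- Where the weights do not vanish `σ` is injective, so each coordinate of `f` is used at most
once. -/
theorem sum_norm_sq_apply_le (σ : J → I) (A : J → (E →L[ℂ] F)) (M : ℝ) (hA : ∀ j, ‖A j‖ ≤ M)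
    (hσ : ∀ i j, A i ≠ 0 → A j ≠ 0 → σ i = σ j → i = j) (f : lp (fun _ : I => E) 2)
    (s : Finset J) :
    ∑ j ∈ s, ‖A j (f (σ j))‖ ^ (2 : ENNReal).toReal ≤ (M * ‖f‖) ^ (2 : ENNReal).toReal := by
  classical
  have h2 : 0 < (2 : ENNReal).toReal := by norm_num
  rw [← Finset.sum_filter_of_ne (p := fun j => A j ≠ 0)]
  · set s' := s.filter fun j => A j ≠ 0
    have hinj : Set.InjOn σ s' := fun i hi j hj h =>
      hσ i j (Finset.mem_filter.1 hi).2 (Finset.mem_filter.1 hj).2 h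
    rcases s'.eq_empty_or_nonempty with h | ⟨j₀, -⟩
    · rw [h, Finset.sum_empty]
      have : 0 ≤ (M * ‖f‖) ^ 2 := sq_nonneg _
      simpa using this
    have hM : 0 ≤ M := (norm_nonneg _).trans (hA j₀)
    calc ∑ j ∈ s', ‖A j (f (σ j))‖ ^ (2 : ENNReal).toReal
        ≤ ∑ j ∈ s', M ^ (2 : ENNReal).toReal * ‖f (σ j)‖ ^ (2 : ENNReal).toReal := by
          refine Finset.sum_le_sum fun j _ => ?_
          rw [← Real.mul_rpow hM (norm_nonneg _)]
          refine Real.rpow_le_rpow (norm_nonneg _) ?_ h2.le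
          exact ((A j).le_opNorm _).trans (mul_le_mul_of_nonneg_right (hA j) (norm_nonneg _))
      _ = M ^ (2 : ENNReal).toReal * ∑ i ∈ s'.image σ, ‖f i‖ ^ (2 : ENNReal).toReal := by
          rw [Finset.sum_image hinj, Finset.mul_sum]
      _ ≤ M ^ (2 : ENNReal).toReal * ‖f‖ ^ (2 : ENNReal).toReal := by
          gcongr
          exact lp.sum_rpow_le_norm_rpow h2 f _
      _ = _ := (Real.mul_rpow hM (norm_nonneg _)).symm
  · intro j _ h h'
    apply h
    rw [h']
    simp

/-- Weighted partial permutations act boundedly on Hilbert sums. -/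
theorem exists_weighted_partial_perm (σ : J → I) (A : J → (E →L[ℂ] F)) (M : ℝ) (hM : 0 ≤ M)
    (hA : ∀ j, ‖A j‖ ≤ M) (hσ : ∀ i j, A i ≠ 0 → A j ≠ 0 → σ i = σ j → i = j) :
    ∃ T : lp (fun _ : I => E) 2 →L[ℂ] lp (fun _ : J => F) 2,
      ‖T‖ ≤ M ∧ ∀ f j, T f j = A j (f (σ j)) := by
  have h2 : 0 < (2 : ENNReal).toReal := by norm_num
  let T : lp (fun _ : I => E) 2 →ₗ[ℂ] lp (fun _ : J => F) 2 :=
    { toFun := fun f => ⟨fun j => A j (f (σ j)), memℓp_gen' (sum_norm_sq_apply_le σ A M hA hσ f)⟩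
      map_add' := fun f g => by ext j; simp; rfl
      map_smul' := fun c f => by ext j; simp }
  have hT : ∀ f, ‖T f‖ ≤ M * ‖f‖ := fun f =>
    lp.norm_le_of_forall_sum_le h2 (by positivity) (sum_norm_sq_apply_le σ A M hA hσ f)
  exact ⟨T.mkContinuous M hT, T.mkContinuous_norm_le hM hT, fun f j => rfl⟩

end BlockOperators

theorem partialProd_last {M : Type*} [Monoid M] {n : ℕ} (t : Fin n → M) :
    Fin.partialProd t (Fin.last n) = (List.ofFn t).prod := by
  simp only [Fin.partialProd, Fin.val_last]
  rw [List.take_of_length_le (by simp)]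

/-! ### Pullback along homomorphisms and induction from subgroups -/

section Functoriality

variable {G : Type u} [Group G] {d : ℕ}

theorem exists_decomposition_comp {N : Type u} [Group N] (f : N →* G) {φ : G → ℂ}
    (D : Decomposition d φ) : ∃ D' : Decomposition d (φ ∘ f), D'.cost ≤ D.cost := by
  have hop : ∀ (n : ℕ) (t : Fin n → N),
      opProd (fun i s => D.ξ i (f s)) n t = opProd D.ξ n fun i => f (t i) := by
    intro n
    induction n with
    | zero => intro t; rfl
    | succ n ih => intro t; rw [opProd, opProd, ih]
  have hb : ∀ i < d, ∀ t, ‖D.ξ i (f t)‖ ≤ ⨆ s, ‖D.ξ i s‖ := fun i hi t =>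
    le_ciSup (D.bounded i hi) (f t)
  refine ⟨{ H := D.H, ξ := fun i s => D.ξ i (f s), e₀ := D.e₀, e₁ := D.e₁, bounded := ?_,
            eq := ?_ }, ?_⟩
  · intro i hi
    exact ⟨_, by rintro _ ⟨t, rfl⟩; exact hb i hi t⟩
  · intro t
    rw [hop, ← D.eq, Function.comp_apply, map_list_prod, List.map_ofFn]
    rfl
  · exact Finset.prod_le_prod (fun i _ => Real.iSup_nonneg fun t => norm_nonneg _)
      fun i hi => ciSup_le fun t => hb i (Finset.mem_range.1 hi) t

variable {N : Type u} [Group N]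

/-- A section of the right cosets of `N` in `G`: every `x` is `ι (s x)` times a coset
representative. -/
structure CosetSection (ι : N →* G) where
  s : G → N
  map_one : s 1 = 1
  map_mul : ∀ n x, s (ι n * x) = n * s x

namespace CosetSection

variable {ι : N →* G} (S : CosetSection ι)

/-- The representative of the coset of `x`. -/
def rep (x : G) : {c : G // S.s c = 1} :=
  ⟨ι (S.s x)⁻¹ * x, by rw [S.map_mul, inv_mul_cancel]⟩

theorem rep_coe (c : {c : G // S.s c = 1}) : S.rep c = c :=
  Subtype.ext (by simp [rep, c.2])

/-- The cocycle identity for `s (j * t)` over the right action `j ↦ rep (j * t)` of `G` on coset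
representatives; `rep_rep_mul` is the action property. -/
theorem s_rep_mul (x t : G) : S.s (S.rep x * t) = (S.s x)⁻¹ * S.s (x * t) := by
  simp only [rep]
  rw [mul_assoc, S.map_mul]

theorem rep_rep_mul (x t : G) : S.rep (S.rep x * t) = S.rep (x * t) := by
  apply Subtype.ext
  change ι (S.s (S.rep x * t))⁻¹ * (S.rep x * t) = ι (S.s (x * t))⁻¹ * (x * t)
  rw [S.s_rep_mul]
  simp [rep, mul_assoc]

theorem rep_map_mul (n : N) (x : G) : S.rep (ι n * x) = S.rep x := by
  apply Subtype.ext
  simp [rep, S.map_mul, mul_assoc]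

theorem eq_of_rep_eq {x y : G} (h : S.rep x = S.rep y) : y = ι (S.s y * (S.s x)⁻¹) * x := by
  have h' : ι (S.s x)⁻¹ * x = ι (S.s y)⁻¹ * y := congrArg Subtype.val h
  rw [_root_.map_mul, mul_assoc, h', ← mul_assoc, ← _root_.map_mul, mul_inv_cancel,
    _root_.map_one, one_mul]

theorem rep_mul_injective (t : G) :
    Function.Injective fun c : {c : G // S.s c = 1} => S.rep (c * t) := by
  intro c c' h
  have h' := S.eq_of_rep_eq h
  rw [← mul_assoc] at h'
  have h1 := mul_right_cancel h'
  have h2 := congrArg S.s h1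
  rw [S.map_mul, c.2, c'.2, mul_one] at h2
  rw [← h2, _root_.map_one, one_mul] at h1
  exact Subtype.ext h1.symm

open scoped Classical in
/-- The function which is `φ` on the coset of `c`, identified with `N`, and `0` elsewhere. -/
noncomputable def extendCoset (c : {c : G // S.s c = 1}) (φ : N → ℂ) (x : G) : ℂ :=
  if S.rep x = c then φ (S.s x) else 0

/-- The induced operators permute the cosets by right translation, with weights `D.ξ i` evaluated at
the cocycle `S.s (j * t)`, so the norm bounds are unchanged. From the coset of `1` to that of `c`,
the cocycle values multiply to `S.s` of the whole product, and the matrix coefficient vanishes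
unless that product lies in the coset of `c`. -/
theorem exists_decomposition_extendCoset (hd : d ≠ 0) (c : {c : G // S.s c = 1}) {φ : N → ℂ}
    (D : Decomposition d φ) :
    ∃ D' : Decomposition d (S.extendCoset c φ), D'.cost ≤ D.cost := by
  classical
  have hb : ∀ i < d, ∀ t, ‖D.ξ i t‖ ≤ ⨆ s, ‖D.ξ i s‖ := fun i hi t => le_ciSup (D.bounded i hi) t
  have hη : ∀ (i : ℕ) (t : G), ∃ T : lp (fun _ : {c : G // S.s c = 1} => D.H (i + 1)) 2 →L[ℂ]
      lp (fun _ : {c : G // S.s c = 1} => D.H i) 2, (i < d → ‖T‖ ≤ ⨆ s, ‖D.ξ i s‖) ∧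
      (i < d → ∀ f j, T f j = D.ξ i (S.s (j * t)) (f (S.rep (j * t)))) := by
    intro i t
    by_cases hi : i < d
    · obtain ⟨T, h, h'⟩ := exists_weighted_partial_perm
        (fun j : {c : G // S.s c = 1} => S.rep (j * t)) (fun j => D.ξ i (S.s (j * t)))
        (⨆ s, ‖D.ξ i s‖) (Real.iSup_nonneg fun _ => norm_nonneg _) (fun j => hb i hi _)
        (fun j k _ _ h => S.rep_mul_injective t h)
      exact ⟨T, fun _ => h, fun _ => h'⟩
    · exact ⟨0, fun h => absurd h hi, fun h => absurd h hi⟩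
  choose η hηn hη using hη
  have hprod : ∀ (n : ℕ), n ≤ d → ∀ (t : Fin n → G) (j : {c : G // S.s c = 1}) f,
      opProd (H := fun i => lp (fun _ : {c : G // S.s c = 1} => D.H i) 2) η n t f j =
        opProd D.ξ n (fun i => (S.s (j * Fin.partialProd t i.castSucc))⁻¹ *
          S.s (j * Fin.partialProd t i.succ)) (f (S.rep (j * Fin.partialProd t (Fin.last n)))) := by
    intro n
    induction n with
    | zero =>
      intro _ t j f
      have : S.rep (j * Fin.partialProd t (Fin.last 0)) = j := by
        rw [show Fin.last 0 = 0 from rfl, Fin.partialProd_zero, mul_one, S.rep_coe]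
      rw [this]
      rfl
    | succ n ih =>
      intro hn t j f
      have hinit : ∀ i : Fin (n + 1), Fin.partialProd (fun i : Fin n => t i.castSucc) i =
          Fin.partialProd t i.castSucc := fun i => Fin.partialProd_init (f := t) i
      rw [opProd, opProd, ContinuousLinearMap.comp_apply, ContinuousLinearMap.comp_apply,
        ih (by omega)]
      refine (congrArg _ (hη n _ (by omega) f _)).trans ?_
      rw [S.s_rep_mul, S.rep_rep_mul, ← Fin.succ_last, Fin.partialProd_succ t (Fin.last n)]
      simp only [hinit, mul_assoc, Fin.succ_castSucc]
  have hD1 : ∀ y, (inner ℂ (D.e₀.symm 1) y : ℂ) = D.e₀ y := fun y => by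
    rw [← D.e₀.inner_map_map, D.e₀.apply_symm_apply]
    simp
  obtain ⟨D', hD'⟩ := exists_decomposition hd
    (K := fun i => lp (fun _ : {c : G // S.s c = 1} => D.H i) 2) η (fun i => ⨆ s, ‖D.ξ i s‖)
    (fun i hi t => hηn i t hi) (lp.single 2 ⟨1, S.map_one⟩ (D.e₀.symm 1))
    (lp.single 2 c (D.e₁.symm 1)) (S.extendCoset c φ) (fun t => by
      have hlast := partialProd_last t
      rw [lp.inner_single_left, hprod d le_rfl, hD1]
      simp only [one_mul]
      rw [hlast, extendCoset]
      split_ifs with h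
      · rw [h, lp.single_apply_self, ← D.eq]
        congr 1
        -- The factors `(s pᵢ)⁻¹ * s pᵢ₊₁` along the partial products `pᵢ` telescope, starting at `s
        -- 1 = 1`.
        have h1 := congrFun (Fin.partialProd_left_inv fun i => S.s (Fin.partialProd t i))
          (Fin.last d)
        simp only [Pi.smul_apply, Fin.partialProd_zero, S.map_one, one_smul, hlast] at h1
        rw [← h1, partialProd_last]
      · rw [lp.single_apply_ne _ _ _ h]
        simp)
  refine ⟨D', hD'.trans ?_⟩
  rw [lp.norm_single (by norm_num), lp.norm_single (by norm_num), D.e₀.symm.norm_map,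
    D.e₁.symm.norm_map]
  simp [Decomposition.cost]

end CosetSection

end Functoriality

/-! ### The pairing with `X_d(G)` and the dual form of the `M_d`-AP -/

section Duality

variable {G : Type u} [Group G] {d : ℕ}

theorem mdNorm_le_cost {φ : G → ℂ} (D : Decomposition d φ) : mdNorm d φ ≤ D.cost :=
  ciInf_le ⟨0, by rintro _ ⟨E, rfl⟩; exact E.cost_nonneg⟩ D

theorem IsMultiplier.of_decomposition (hd : d ≠ 0) {φ : G → ℂ} (D : Decomposition d φ) :
    IsMultiplier d φ :=
  ⟨⟨_, fun t => D.norm_le_cost hd t⟩, ⟨D⟩⟩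

theorem mdNorm_one_le : mdNorm d (fun _ : G => (1 : ℂ)) ≤ 1 := by
  rcases eq_or_ne d 0 with rfl | hd
  · obtain ⟨D⟩ := (isMultiplier_one G 0).decomposable
    refine (mdNorm_le_cost D).trans ?_
    simp [Decomposition.cost]
  let E := lp (fun _ : PUnit.{u + 1} => ℂ) 2
  let e : E := lp.single 2 PUnit.unit 1
  have he : ‖e‖ = 1 := by rw [lp.norm_single (by norm_num), norm_one]
  have h1 : (fun _ : G => (1 : ℂ)) = fun _ => inner ℂ e e := by
    funext; rw [inner_self_eq_norm_sq_to_K, he]; simp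
  rw [h1]
  obtain ⟨D, hD⟩ := exists_decomposition_of_invariant (G := G) hd (fun _ => e) e fun _ _ _ => rfl
  refine (mdNorm_le_cost D).trans (hD.trans ?_)
  rw [he, one_mul]

/-- Finitely supported functions are multipliers, as coefficients of the regular representation. -/
theorem isMultiplier_of_finite_support (hd : d ≠ 0) {φ : G → ℂ}
    (hφ : (Function.support φ).Finite) : IsMultiplier d φ := by
  classical
  let v : G → lp (fun _ : G => ℂ) 2 := fun s => lp.single 2 s 1
  let w : lp (fun _ : G => ℂ) 2 := ∑ s ∈ hφ.toFinset, lp.single 2 s (star (φ s))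
  have hv : ∀ g x y, (inner ℂ (v (g * x)) (v (g * y)) : ℂ) = inner ℂ (v x) (v y) := by
    intro g x y
    simp only [v, lp.inner_single_left, lp.single_apply, Pi.single_apply, mul_right_inj]
  obtain ⟨D, -⟩ := exists_decomposition_of_invariant hd v w hv
  have h : (fun s => inner ℂ w (v s)) = φ := by
    funext s
    simp only [v, w, sum_inner, lp.inner_single_right, lp.single_apply, Pi.single_apply]
    by_cases hs : φ s = 0 <;> simp [apply_ite (starRingEnd ℂ), hs]
  rw [h] at D
  exact .of_decomposition hd D

open scoped Classical in
/-- The point mass at `g`. -/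
noncomputable def delta (hd : d ≠ 0) (g : G) : Md G d :=
  ⟨Pi.single g 1, isMultiplier_of_finite_support hd
    ((Set.finite_singleton g).subset Pi.support_single_subset)⟩

theorem continuous_xdPairing (φ : Md G d) : Continuous (xdPairing φ) :=
  UniformSpace.Completion.continuous_extension

theorem xdPairing_coe' (hd : d ≠ 0) (φ : Md G d) (y : PreXd G d) :
    xdPairing φ (y : Xd G d) = pairing φ (toEll1 G d y) :=
  xdPairing_coe hd φ y

theorem norm_xdPairing_le (hd : d ≠ 0) (φ : Md G d) (x : Xd G d) :
    ‖xdPairing φ x‖ ≤ mdNorm d φ.1 * ‖x‖ := by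
  induction x using UniformSpace.Completion.induction_on with
  | hp => exact isClosed_le (continuous_xdPairing φ).norm (continuous_const.mul continuous_norm)
  | ih y =>
    rw [xdPairing_coe' hd, UniformSpace.Completion.norm_coe]
    exact norm_pairing_le hd φ _

theorem xdPairing_sub (hd : d ≠ 0) (φ : Md G d) (x y : Xd G d) :
    xdPairing φ (x - y) = xdPairing φ x - xdPairing φ y := by
  induction x, y using UniformSpace.Completion.induction_on₂ with
  | hp =>
    have h := continuous_xdPairing φ
    exact isClosed_eq (h.comp continuous_sub)
      ((h.comp continuous_fst).sub (h.comp continuous_snd))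
  | ih x y =>
    rw [← UniformSpace.Completion.coe_sub, xdPairing_coe' hd, xdPairing_coe' hd,
      xdPairing_coe' hd, map_sub, map_sub]

theorem xdPairing_zero (hd : d ≠ 0) (φ : Md G d) : xdPairing φ 0 = 0 := by
  simpa using xdPairing_sub hd φ 0 0

theorem xdPairing_add (hd : d ≠ 0) (φ : Md G d) (x y : Xd G d) :
    xdPairing φ (x + y) = xdPairing φ x + xdPairing φ y := by
  have h1 := xdPairing_sub hd φ (x + y) y
  rw [add_sub_cancel_right] at h1
  rw [h1, sub_add_cancel]

theorem xdPairing_sum (hd : d ≠ 0) {I : Type*} (s : Finset I) (a : I → ℂ) (ψ : I → Md G d)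
    (φ : Md G d) (h : ∀ t, φ.1 t = ∑ i ∈ s, a i * (ψ i).1 t) (x : Xd G d) :
    xdPairing φ x = ∑ i ∈ s, a i * xdPairing (ψ i) x := by
  induction x using UniformSpace.Completion.induction_on with
  | hp =>
    exact isClosed_eq (continuous_xdPairing φ)
      (continuous_finsetSum _ fun i _ => continuous_const.mul (continuous_xdPairing _))
  | ih y =>
    simp only [xdPairing_coe hd, ← tsum_mul_left]
    rw [← Summable.tsum_finsetSum fun i _ =>
      (summable_pairing (ψ i).2.bounded (toEll1 G d y)).mul_left (a i)]
    refine tsum_congr fun t => ?_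
    rw [h, Finset.sum_mul]
    exact Finset.sum_congr rfl fun i _ => mul_assoc _ _ _

theorem xdPairing_eq_sum_delta (hd : d ≠ 0) (φ : Md G d) (s : Finset G)
    (hs : ∀ t, φ.1 t ≠ 0 → t ∈ s) (x : Xd G d) :
    xdPairing φ x = ∑ g ∈ s, φ.1 g * xdPairing (delta hd g) x := by
  classical
  refine xdPairing_sum hd s φ.1 (delta hd) φ (fun t => ?_) x
  have h : ∀ g, φ.1 g * (delta hd g).1 t = if t = g then φ.1 g else 0 := fun g => by
    simp [delta, Pi.single_apply]
  simp only [h, Finset.sum_ite_eq]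
  split_ifs with hts
  · rfl
  · by_contra h0; exact hts (hs t h0)

theorem xdPairing_eq_zero_of_finite (hd : d ≠ 0) {x : Xd G d}
    (hx : ∀ g, xdPairing (delta hd g) x = 0) (φ : Md G d) (hφ : φ ∈ Cc G d) :
    xdPairing φ x = 0 := by
  have hφ' : (Function.support φ.1).Finite := hφ
  rw [xdPairing_eq_sum_delta hd φ hφ'.toFinset (by simp)]
  simp [hx]

theorem exists_xdMap {G' : Type u} [Group G'] (T : Ell1 G →+ Ell1 G') (C : ℝ)
    (hT : ∀ y, xdSeminorm G' d (T y) ≤ C * xdSeminorm G d y) :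
    ∃ S : Xd G d → Xd G' d, Continuous S ∧ ∀ y : PreXd G d,
      S y = ((toEll1 G' d).symm (T (toEll1 G d y)) : PreXd G' d) := by
  let T' : PreXd G d →+ PreXd G' d :=
    ((toEll1 G' d).symm.toAddMonoidHom.comp T).comp (toEll1 G d).toAddMonoidHom
  have hT' : Continuous T' := AddMonoidHomClass.continuous_of_bound T' C hT
  refine ⟨UniformSpace.Completion.map T', UniformSpace.Completion.continuous_map, fun y => ?_⟩
  exact UniformSpace.Completion.map_coe (uniformContinuous_addMonoidHom_of_continuous hT') y

/-- `PreXd` is only given the structure of a seminormed additive group, so the scalar multiple comes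
from extending multiplication by `c` to the completion. -/
theorem exists_xd_smul (hd : d ≠ 0) (c : ℂ) (x : Xd G d) :
    ∃ x' : Xd G d, ∀ φ, xdPairing φ x' = c * xdPairing φ x := by
  obtain ⟨S, hS, hS'⟩ := exists_xdMap (d := d) (G := G)
    (DistribMulAction.toAddMonoidEnd ℂ (Ell1 G) c) ‖c‖
    (fun y => (map_smul_eq_mul (xdSeminorm G d) c y).le)
  refine ⟨S x, fun φ => ?_⟩
  induction x using UniformSpace.Completion.induction_on with
  | hp =>
    have h := continuous_xdPairing φ
    exact isClosed_eq (h.comp hS) (continuous_const.mul h)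
  | ih y =>
    rw [hS', xdPairing_coe' hd, xdPairing_coe' hd, AddEquiv.apply_symm_apply]
    exact map_smul (pairing φ) c _

theorem exists_xd_linearCombination (hd : d ≠ 0) {I : Type*} (s : Finset I) (c : I → ℂ)
    (x : I → Xd G d) : ∃ x' : Xd G d, ∀ φ, xdPairing φ x' = ∑ i ∈ s, c i * xdPairing φ (x i) := by
  choose y hy using fun i => exists_xd_smul hd (c i) (x i)
  classical
  refine ⟨∑ i ∈ s, y i, fun φ => ?_⟩
  induction s using Finset.induction_on with
  | empty => simpa using xdPairing_zero hd φ
  | insert i s hi ih => rw [Finset.sum_insert hi, Finset.sum_insert hi, xdPairing_add hd, ih, hy]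

/-- The `M_d`-AP by duality: no element of `X_d(G)` separates `1` from the point masses. -/
theorem hasMdAP_iff (hd : d ≠ 0) :
    HasMdAP G d ↔ ∀ x : Xd G d, (∀ g, xdPairing (delta hd g) x = 0) →
      xdPairing (Md.one G d) x = 0 := by
  classical
  constructor
  · intro h x hx
    let _ := weakStar G d
    have hc : Continuous fun φ : Md G d => xdPairing φ x :=
      continuous_iff_le_induced.2 (iInf_le _ x)
    have hcl : IsClosed {φ : Md G d | xdPairing φ x = 0} := isClosed_eq hc continuous_const
    exact closure_minimal (fun φ hφ => xdPairing_eq_zero_of_finite hd hx φ hφ) hcl h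
  · intro h
    have htop : weakStar G d = TopologicalSpace.induced
        (fun (φ : Md G d) (x : Xd G d) => xdPairing φ x) Pi.topologicalSpace := by
      rw [weakStar, Pi.topologicalSpace, induced_iInf]
      simp only [induced_compose]
      rfl
    rw [HasMdAP, htop, closure_induced, mem_closure_iff_nhds]
    intro U hU
    rw [nhds_pi, Filter.mem_pi] at hU
    obtain ⟨I, hI, V, hV, hVU⟩ := hU
    let J := hI.toFinset
    let Λ : Md G d → J → ℂ := fun φ i => xdPairing φ i.1
    -- A basic neighbourhood sees only the finitely many coordinates in `J`. If `Λ 1` were outside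
    -- the span of the `Λ (delta g)`, a functional on `ℂ^J` would separate it, and the corresponding
    -- combination of elements of `J` would contradict `h`.
    have key : Λ (Md.one G d) ∈ Submodule.span ℂ (Set.range fun g => Λ (delta hd g)) := by
      by_contra hn
      obtain ⟨f, hf, hf'⟩ := Submodule.exists_le_ker_of_notMem hn
      obtain ⟨x, hx⟩ := exists_xd_linearCombination hd (Finset.univ : Finset J)
        (fun i => f (Pi.single i 1)) fun i => i.1
      have hx' : ∀ φ, xdPairing φ x = f (Λ φ) := fun φ => by
        rw [hx, f.pi_apply_eq_sum_univ (Λ φ)]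
        refine Finset.sum_congr rfl fun i _ => ?_
        rw [smul_eq_mul, mul_comm]
        congr 3
        ext j
        simp [Pi.single_apply, eq_comm]
      refine hf ?_
      rw [← hx']
      refine h x fun g => ?_
      rw [hx']
      exact hf' (Submodule.subset_span ⟨g, rfl⟩)
    obtain ⟨a, ha⟩ := Finsupp.mem_span_range_iff_exists_finsupp.1 key
    let φ : Md G d := ⟨a, isMultiplier_of_finite_support hd a.hasFiniteSupport⟩
    -- The finitely supported `φ` has exactly the same coordinates in `J` as `1`, so no
    -- approximation is needed.
    refine ⟨fun x => xdPairing φ x, hVU fun i hi => ?_, φ, a.hasFiniteSupport, rfl⟩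
    have hi' := congrFun ha ⟨i, hI.mem_toFinset.2 hi⟩
    have h1 : xdPairing φ i = xdPairing (Md.one G d) i := by
      rw [xdPairing_eq_sum_delta hd φ a.support (by simp [φ])]
      simpa [Finsupp.sum, Λ] using hi'
    change xdPairing φ i ∈ V i
    rw [h1]
    exact mem_of_mem_nhds (hV i)

/-- Bounded pointwise limits in `M_d(G)` are limits for `σ(M_d(G), X_d(G))`. -/
theorem tendsto_xdPairing (hd : d ≠ 0) {I : Type*} {l : Filter I} (φ : I → Md G d) (ψ : Md G d)
    (C : ℝ) (hC : ∀ i, mdNorm d (φ i).1 ≤ C)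
    (h : ∀ t, Filter.Tendsto (fun i => (φ i).1 t) l (𝓝 (ψ.1 t)))
    (x : Xd G d) : Filter.Tendsto (fun i => xdPairing (φ i) x) l (𝓝 (xdPairing ψ x)) := by
  rcases isEmpty_or_nonempty I with hI | ⟨⟨i₀⟩⟩
  · rw [Filter.filter_eq_bot_of_isEmpty l]; exact Filter.tendsto_bot
  have hC0 : 0 ≤ C := (mdNorm_nonneg _).trans (hC i₀)
  have hcoe : ∀ y : PreXd G d, Filter.Tendsto (fun i => xdPairing (φ i) (y : Xd G d)) l
      (𝓝 (xdPairing ψ (y : Xd G d))) := fun y => by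
    simp only [xdPairing_coe hd]
    have hy : Summable fun t => ‖toEll1 G d y t‖ := by
      simpa using (lp.memℓp (toEll1 G d y)).summable (by norm_num)
    refine tendsto_tsum_of_dominated_convergence (hy.mul_left C) (fun t => (h t).mul_const _)
      (.of_forall fun i t => ?_)
    rw [norm_mul]
    exact mul_le_mul_of_nonneg_right ((norm_le_mdNorm hd (φ i) t).trans (hC i)) (norm_nonneg _)
  rw [Metric.tendsto_nhds]
  intro ε hε
  -- The summand `1` only makes `B` positive, so that `ε / (2 * B)` is a legitimate radius.
  set B := C + mdNorm d ψ.1 + 1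
  have hB : 0 < B := by have := mdNorm_nonneg (d := d) ψ.1; positivity
  obtain ⟨y, hy⟩ : ∃ y : PreXd G d, ‖x - y‖ < ε / (2 * B) := by
    obtain ⟨y, hy⟩ := UniformSpace.Completion.denseRange_coe.exists_dist_lt x
      (show 0 < ε / (2 * B) by positivity)
    exact ⟨y, by rwa [dist_eq_norm] at hy⟩
  filter_upwards [Metric.tendsto_nhds.1 (hcoe y) (ε / 2) (by positivity)] with i hi
  rw [dist_eq_norm] at hi ⊢
  have h1 := norm_xdPairing_le hd (φ i) (x - y)
  have h2 := norm_xdPairing_le hd ψ (x - y)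
  rw [xdPairing_sub hd] at h1 h2
  have h3 : xdPairing (φ i) x - xdPairing ψ x =
      (xdPairing (φ i) x - xdPairing (φ i) y) + (xdPairing (φ i) y - xdPairing ψ y) -
        (xdPairing ψ x - xdPairing ψ y) := by ring
  have h4 : (C + mdNorm d ψ.1) * ‖x - y‖ ≤ ε / 2 := by
    calc (C + mdNorm d ψ.1) * ‖x - y‖ ≤ B * (ε / (2 * B)) := by
          gcongr
          exact (lt_add_one _).le
      _ = ε / 2 := by field_simp
  have h5 : mdNorm d (φ i).1 * ‖x - y‖ ≤ C * ‖x - y‖ :=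
    mul_le_mul_of_nonneg_right (hC i) (norm_nonneg _)
  rw [h3]
  refine (norm_sub_le _ _).trans_lt ?_
  have h6 := norm_add_le (xdPairing (φ i) x - xdPairing (φ i) y)
    (xdPairing (φ i) y - xdPairing ψ y)
  linarith

end Duality

/-! ### Subgroups, extensions, directed unions -/

section Permanence

variable {G G' N Q : Type u} [Group G] [Group G'] [Group N] [Group Q] {d : ℕ}

/-- The nonemptiness assumption matters: the infimum over an empty type is `0`. -/
theorem mdNorm_le_mdNorm {φ : G → ℂ} {ψ : G' → ℂ} (hφ : Nonempty (Decomposition d φ))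
    (h : ∀ D : Decomposition d φ, ∃ D' : Decomposition d ψ, D'.cost ≤ D.cost) :
    mdNorm d ψ ≤ mdNorm d φ :=
  le_ciInf fun D => have ⟨D', hD'⟩ := h D; (mdNorm_le_cost D').trans hD'

/-- The pairing with a multiplier, as a continuous functional on `ℓ¹(G)`. -/
theorem exists_pairingCLM (φ : Md G d) : ∃ L : Ell1 G →L[ℂ] ℂ, ∀ y, L y = pairing φ y := by
  obtain ⟨C, hC⟩ := φ.2.bounded
  refine ⟨(pairing φ).mkContinuous C fun y => ?_, fun y => rfl⟩
  have hy := lp.hasSum_norm (p := 1) (by norm_num) y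
  simp only [ENNReal.toReal_one, Real.rpow_one] at hy
  refine tsum_of_norm_bounded (hy.mul_left C) fun t => ?_
  rw [norm_mul]
  exact mul_le_mul_of_nonneg_right (hC t) (norm_nonneg _)

theorem pairing_single [DecidableEq G] (φ : Md G d) (g : G) (a : ℂ) :
    pairing φ (lp.single (E := fun _ => ℂ) 1 g a) = φ.1 g * a := by
  change ∑' t, φ.1 t * lp.single (E := fun _ => ℂ) 1 g a t = _
  rw [tsum_eq_single g fun t ht => by rw [lp.single_apply_ne _ _ _ ht, mul_zero],
    lp.single_apply_self]

/-- The map `ℓ¹(G) → ℓ¹(G')` which sums over the fibres of a partial map. -/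
theorem exists_fiberSum (f : G → Option G') :
    ∃ T : Ell1 G →+ Ell1 G', ∀ (φ : Md G' d) (ψ : Md G d),
      (∀ g, ψ.1 g = (f g).elim 0 φ.1) → ∀ y, pairing φ (T y) = pairing ψ y := by
  classical
  let J : G → ℂ →+ Ell1 G' := fun g =>
    (f g).elim 0 fun g' => lp.singleAddMonoidHom (E := fun _ => ℂ) 1 g'
  have hJ : ∀ g a, ‖J g a‖ ≤ ‖a‖ := fun g a => by
    simp only [J]
    cases f g with
    | none => simp
    | some g' => exact (lp.norm_single (E := fun _ => ℂ) (by norm_num) g' a).le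
  have hsum : ∀ y : Ell1 G, Summable fun g => J g (y g) := fun y => by
    have hy : Summable fun t => ‖y t‖ := by
      simpa using (lp.memℓp y).summable (by norm_num)
    exact Summable.of_norm_bounded hy fun g => hJ g _
  refine ⟨{ toFun := fun y => ∑' g, J g (y g), map_zero' := by simp, map_add' := ?_ }, ?_⟩
  · intro y z
    rw [← (hsum y).tsum_add (hsum z)]
    exact tsum_congr fun g => map_add (J g) _ _
  · intro φ ψ h y
    obtain ⟨L, hL⟩ := exists_pairingCLM φ
    change pairing φ (∑' g, J g (y g)) = ∑' g, ψ.1 g * y g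
    rw [← hL, L.map_tsum (hsum y)]
    refine tsum_congr fun g => ?_
    rw [hL, h]
    simp only [J]
    cases f g with
    | none => simp
    | some g' => exact pairing_single φ g' _

/-- A partial map `G → G'` along which multipliers pull back contractively induces a map
`X_d(G) → X_d(G')`. -/
theorem exists_predual (hd : d ≠ 0) (f : G → Option G')
    (hf : ∀ φ : G' → ℂ, ∀ D : Decomposition d φ,
      ∃ D' : Decomposition d (fun g => (f g).elim 0 φ), D'.cost ≤ D.cost) :
    ∃ S : Xd G d → Xd G' d, ∀ (φ : Md G' d) (ψ : Md G d),
      (∀ g, ψ.1 g = (f g).elim 0 φ.1) → ∀ x, xdPairing φ (S x) = xdPairing ψ x := by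
  obtain ⟨T, hT⟩ := exists_fiberSum (d := d) f
  have hbound : ∀ y, xdSeminorm G' d (T y) ≤ 1 * xdSeminorm G d y := by
    intro y
    rw [one_mul, xdSeminorm_apply hd]
    have : Nonempty {φ : Md G' d // mdNorm d φ.1 ≤ 1} := ⟨⟨Md.one G' d, mdNorm_one_le⟩⟩
    refine ciSup_le fun φ => ?_
    obtain ⟨D⟩ := φ.1.2.decomposable
    obtain ⟨D', -⟩ := hf _ D
    let ψ : Md G d := ⟨_, .of_decomposition hd D'⟩
    have h1 : mdNorm d ψ.1 ≤ 1 := (mdNorm_le_mdNorm ⟨D⟩ (hf _)).trans φ.2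
    change ‖pairing φ.1 (T y)‖ ≤ _
    rw [hT φ.1 ψ fun _ => rfl]
    exact (norm_pairing_le hd ψ y).trans (mul_le_of_le_one_left (apply_nonneg _ _) h1)
  obtain ⟨S, hS, hS'⟩ := exists_xdMap T 1 hbound
  refine ⟨S, fun φ ψ h x => ?_⟩
  induction x using UniformSpace.Completion.induction_on with
  | hp => exact isClosed_eq ((continuous_xdPairing φ).comp hS) (continuous_xdPairing ψ)
  | ih y =>
    rw [hS', xdPairing_coe' hd, xdPairing_coe' hd, AddEquiv.apply_symm_apply]
    exact hT φ ψ h _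

theorem exists_xd_pushforward (hd : d ≠ 0) (f : G →* G') :
    ∃ S : Xd G d → Xd G' d, ∀ (φ : Md G' d) (ψ : Md G d),
      (∀ g, ψ.1 g = φ.1 (f g)) → ∀ x, xdPairing φ (S x) = xdPairing ψ x :=
  exists_predual hd (fun g => some (f g)) fun _ D => exists_decomposition_comp f D

/-- The `M_d`-AP passes to subgroups. -/
theorem HasMdAP.of_injective (hd : d ≠ 0) (h : HasMdAP G d) (f : N →* G)
    (hf : Function.Injective f) : HasMdAP N d := by
  classical
  rw [hasMdAP_iff hd] at h ⊢
  intro x hx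
  obtain ⟨S, hS⟩ := exists_xd_pushforward hd f
  rw [← hS (Md.one G d) (Md.one N d) fun _ => rfl]
  refine h _ fun g => ?_
  have hfin : (Function.support ((delta hd g).1 ∘ f)).Finite := by
    refine ((Set.finite_singleton g).preimage hf.injOn).subset fun n hn => ?_
    by_contra hne
    exact hn (Pi.single_eq_of_ne hne 1)
  let ψ : Md N d := ⟨_, isMultiplier_of_finite_support hd hfin⟩
  rw [hS _ ψ fun _ => rfl]
  exact xdPairing_eq_zero_of_finite hd hx ψ hfin

/-- If `N` has the `M_d`-AP, the indicators of its cosets are `σ(M_d(G), X_d(G))`-limits of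
finitely supported functions. -/
theorem xdPairing_coset_eq_zero (hd : d ≠ 0) (hN : HasMdAP N d) {ι : N →* G}
    (S : CosetSection ι) (c : {c : G // S.s c = 1}) {x : Xd G d}
    (hx : ∀ g, xdPairing (delta hd g) x = 0) (ψ : Md G d)
    (hψ : ∀ g, ψ.1 g = S.extendCoset c (fun _ => 1) g) : xdPairing ψ x = 0 := by
  classical
  have helim : ∀ (φ : N → ℂ) (g : G),
      (if S.rep g = c then some (S.s g) else none).elim 0 φ = S.extendCoset c φ g := by
    intro φ g
    rw [CosetSection.extendCoset]
    split_ifs <;> rfl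
  obtain ⟨R, hR⟩ := exists_predual hd (fun g => if S.rep g = c then some (S.s g) else none)
    fun φ D => by
      rw [show (fun g => (if S.rep g = c then some (S.s g) else none).elim 0 φ) =
        S.extendCoset c φ from funext (helim φ)]
      exact S.exists_decomposition_extendCoset hd c D
  simp only [helim] at hR
  rw [← hR (Md.one N d) ψ hψ]
  -- The point mass at `n` pulls back to a function supported in `{ι n * c}`, which `x` annihilates.
  refine (hasMdAP_iff hd).1 hN _ fun n => ?_
  have hfin : (Function.support (S.extendCoset c (delta hd n).1)).Finite := by
    refine (Set.finite_singleton (ι n * c)).subset fun g hg => ?_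
    rw [Function.mem_support, CosetSection.extendCoset] at hg
    split_ifs at hg with h
    · have hn : S.s g = n := by
        by_contra hne
        exact hg (Pi.single_eq_of_ne hne 1)
      rw [← hn, ← h, Set.mem_singleton_iff]
      simp [CosetSection.rep]
    · exact absurd rfl hg
  rw [hR _ ⟨_, isMultiplier_of_finite_support hd hfin⟩ fun _ => rfl]
  exact xdPairing_eq_zero_of_finite hd hx _ hfin

/-- The `M_d`-AP is stable under extensions. -/
theorem HasMdAP.extension (hd : d ≠ 0) (hN : HasMdAP N d) (hQ : HasMdAP Q d) {ι : N →* G}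
    (S : CosetSection ι) (π : G →* Q) (hπ : Function.Surjective π) (hι : ∀ n, π (ι n) = 1)
    (hker : ∀ g, π g = 1 → ∃ n, ι n = g) : HasMdAP G d := by
  classical
  rw [hasMdAP_iff hd]
  intro x hx
  obtain ⟨P, hP⟩ := exists_xd_pushforward hd π
  rw [← hP (Md.one Q d) (Md.one G d) fun _ => rfl]
  refine (hasMdAP_iff hd).1 hQ _ fun q => ?_
  obtain ⟨D⟩ := (delta hd q).2.decomposable
  obtain ⟨D', -⟩ := exists_decomposition_comp π D
  rw [hP _ ⟨_, .of_decomposition hd D'⟩ fun _ => rfl]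
  obtain ⟨h, rfl⟩ := hπ q
  -- The pullback of the point mass at `π h` is the indicator of the coset of `h`, since `π` has
  -- kernel `ι N`.
  refine xdPairing_coset_eq_zero hd hN S (S.rep h) hx _ fun g => ?_
  simp only [delta, Function.comp_apply, Pi.single_apply, CosetSection.extendCoset]
  refine if_congr ⟨fun hg => ?_, fun hg => ?_⟩ rfl rfl
  · obtain ⟨n, hn⟩ := hker (g * h⁻¹) (by rw [map_mul, map_inv, hg, mul_inv_cancel])
    rw [← S.rep_map_mul n h, hn, inv_mul_cancel_right]
  · rw [S.eq_of_rep_eq hg.symm, map_mul, hι, one_mul]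

/-- The `M_d`-AP is stable under directed unions of subgroups. -/
theorem HasMdAP.of_directed (hd : d ≠ 0) {I : Type*} {l : Filter I} [l.NeBot] {N : I → Type u}
    [∀ i, Group (N i)] (hN : ∀ i, HasMdAP (N i) d) {ι : ∀ i, N i →* G}
    (S : ∀ i, CosetSection (ι i)) (hl : ∀ g, ∀ᶠ i in l, g ∈ Set.range (ι i)) :
    HasMdAP G d := by
  rw [hasMdAP_iff hd]
  intro x hx
  have h1 : ∀ i, ∃ D : Decomposition d ((S i).extendCoset ((S i).rep 1) fun _ => 1),
      mdNorm d ((S i).extendCoset ((S i).rep 1) fun _ => 1) ≤ 1 := fun i => by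
    obtain ⟨D⟩ := (isMultiplier_one (N i) d).decomposable
    obtain ⟨D', -⟩ := (S i).exists_decomposition_extendCoset hd ((S i).rep 1) D
    exact ⟨D', (mdNorm_le_mdNorm ⟨D⟩
      ((S i).exists_decomposition_extendCoset hd ((S i).rep 1))).trans mdNorm_one_le⟩
  choose D hD using h1
  -- The indicators of the subgroups have norm at most `1` and converge pointwise to `1`.
  have hlim := tendsto_xdPairing hd (l := l) (fun i => ⟨_, .of_decomposition hd (D i)⟩)
    (Md.one G d) 1 hD
    (fun g => by
      refine tendsto_const_nhds.congr' ?_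
      filter_upwards [hl g] with i hi
      obtain ⟨n, rfl⟩ := hi
      have : (S i).rep (ι i n) = (S i).rep 1 := by
        simpa using (S i).rep_map_mul n 1
      simp [CosetSection.extendCoset, this, Md.one]) x
  refine tendsto_nhds_unique hlim (tendsto_const_nhds.congr fun i => ?_)
  exact (xdPairing_coset_eq_zero hd (hN i) (S i) ((S i).rep 1) hx _ fun _ => rfl).symm

theorem HasMdAP.prod (hd : d ≠ 0) (hG : HasMdAP G d) (hG' : HasMdAP G' d) :
    HasMdAP (G × G') d := by
  let S : CosetSection (MonoidHom.inl G G') :=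
    { s := Prod.fst, map_one := rfl, map_mul := fun _ _ => rfl }
  refine HasMdAP.extension hd hG hG' S (MonoidHom.snd G G') Prod.snd_surjective
    (fun _ => rfl) fun g hg => ⟨g.1, Prod.ext rfl hg.symm⟩

theorem HasMdAP.semidirectProduct (hd : d ≠ 0) (hN : HasMdAP N d) (hG : HasMdAP G d)
    (α : G →* MulAut N) : HasMdAP (N ⋊[α] G) d := by
  let S : CosetSection (SemidirectProduct.inl : N →* N ⋊[α] G) :=
    { s := SemidirectProduct.left, map_one := rfl, map_mul := fun n x => by simp }
  refine HasMdAP.extension hd hN hG S SemidirectProduct.rightHom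
    SemidirectProduct.rightHom_surjective (fun _ => by simp) fun g hg => ⟨g.left, ?_⟩
  exact SemidirectProduct.ext (by simp) (by simpa using hg.symm)

end Permanence

/-! ### Embedding the free product into a semidirect product with a free group -/

section FreeProduct

variable {G₁ G₂ : Type u} [Group G₁] [Group G₂]

/-- The action of `H` on the free group with basis `H` by translations of the basis. -/
def translateBasis (H : Type u) [Group H] : H →* MulAut (FreeGroup H) where
  toFun h := FreeGroup.freeGroupCongr (Equiv.mulLeft h)
  map_one' := by
    ext x
    induction x using FreeGroup.induction_on <;> simp_all
  map_mul' h k := by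
    ext x
    induction x using FreeGroup.induction_on <;> simp_all [mul_assoc]

theorem translateBasis_of {H : Type u} [Group H] (h k : H) :
    translateBasis H h (FreeGroup.of k) = FreeGroup.of (h * k) := by
  simp [translateBasis]

/-- If `K` is a retract of `G` then `G × K` and `K × G` are isomorphic as `K`-sets, where `K` acts
on the left factors. -/
def retractEquiv {G K : Type*} [Group G] [Group K] (i : K →* G) (p : G →* K)
    (h : ∀ k, p (i k) = k) : G × K ≃ K × G where
  -- The second component is unchanged when `x.1` is replaced by `i k * x.1`, while the first is
  -- multiplied by `k`: this is the equivariance.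
  toFun x := (p x.1, i (x.2 * (p x.1)⁻¹) * x.1)
  invFun y := (i (y.1 * (p y.2)⁻¹) * y.2, p y.2)
  left_inv x := by simp [h, mul_assoc]
  right_inv y := by simp [h, mul_assoc]

/-- The action of `H` on `H × Y` by left translations of the first factor. -/
def leftPerm (H Y : Type*) [Group H] : H →* Equiv.Perm (H × Y) where
  toFun h := (Equiv.mulLeft h).prodCongr (Equiv.refl Y)
  map_one' := by ext x <;> simp
  map_mul' h k := by ext x <;> simp [mul_assoc]

theorem leftPerm_apply {H Y : Type*} [Group H] (h : H) (x : H × Y) :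
    leftPerm H Y h x = (h * x.1, x.2) := rfl

open Monoid.Coprod in
/-- `G₁ * G₂` embeds into the semidirect product of `G₁ × G₂` and the free group with basis
`G₁ × G₂`, as `G₁` and the conjugate of `G₂` by a basis element. -/
theorem exists_coprod_embedding :
    ∃ f : Monoid.Coprod G₁ G₂ →* FreeGroup (G₁ × G₂) ⋊[translateBasis (G₁ × G₂)] (G₁ × G₂),
      Function.Injective f := by
  let H := G₁ × G₂
  let G := Monoid.Coprod G₁ G₂
  let e₁ := retractEquiv (inl : G₁ →* G) fst (fun k => fst_apply_inl k)
  let e₂ := retractEquiv (inr : G₂ →* G) snd (fun k => snd_apply_inr k)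
  let θ₁ : G × H ≃ H × G :=
    { toFun := fun x => (((e₁ (x.1, x.2.1)).1, x.2.2), (e₁ (x.1, x.2.1)).2)
      invFun := fun y =>
        ((e₁.symm (y.1.1, y.2)).1, ((e₁.symm (y.1.1, y.2)).2, y.1.2))
      left_inv := fun x => by simp
      right_inv := fun x => by simp }
  let θ₂ : G × H ≃ H × G :=
    { toFun := fun x => ((x.2.1, (e₂ (x.1, x.2.2)).1), (e₂ (x.1, x.2.2)).2)
      invFun := fun y =>
        ((e₂.symm (y.1.2, y.2)).1, (y.1.1, (e₂.symm (y.1.2, y.2)).2))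
      left_inv := fun x => by simp
      right_inv := fun x => by simp }
  have hθ₁ : ∀ g x, θ₁ (leftPerm G H (inl g) x) = leftPerm H G (g, 1) (θ₁ x) := fun g x => by
    simp [leftPerm_apply, θ₁, e₁, retractEquiv, mul_assoc]
    exact Prod.ext rfl (one_mul _).symm
  have hθ₂ : ∀ g x, θ₂ (leftPerm G H (inr g) x) = leftPerm H G (1, g) (θ₂ x) := fun g x => by
    simp [leftPerm_apply, θ₂, e₂, retractEquiv, mul_assoc]
    exact Prod.ext (one_mul _).symm rfl
  -- `ρ` moves the translation action of `H` to `G × H` through `θ₁`, so `G₁` acts by left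
  -- multiplication on `G`. For `G₂` this holds through `θ₂` instead, and conjugation by `t = θ₂⁻¹ ∘
  -- θ₁` passes from one to the other. Sending the basis element `h` to the conjugate of `t` by `ρ
  -- h` makes `F` compatible with translation of the basis.
  let ρ : H →* Equiv.Perm (G × H) := θ₁.symm.permCongrHom.toMonoidHom.comp (leftPerm H G)
  have hρ : ∀ h x, ρ h x = θ₁.symm (leftPerm H G h (θ₁ x)) := fun h x => rfl
  let t : Equiv.Perm (G × H) := θ₁.trans θ₂.symm
  let F : FreeGroup H →* Equiv.Perm (G × H) := FreeGroup.lift fun h => ρ h * t * (ρ h)⁻¹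
  have hF : ∀ h, F (FreeGroup.of h) = ρ h * t * (ρ h)⁻¹ := fun h => FreeGroup.lift_apply_of
  let r : FreeGroup H ⋊[translateBasis H] H →* Equiv.Perm (G × H) :=
    SemidirectProduct.lift F ρ fun h => by
      refine FreeGroup.ext_hom _ _ fun k => ?_
      simp [translateBasis_of, hF, mul_assoc]
  let τ : FreeGroup H ⋊[translateBasis H] H := SemidirectProduct.inl (FreeGroup.of 1)
  let f : G →* FreeGroup H ⋊[translateBasis H] H :=
    lift (SemidirectProduct.inr.comp (MonoidHom.inl G₁ G₂))
      ((MulAut.conj τ).toMonoidHom.comp (SemidirectProduct.inr.comp (MonoidHom.inr G₁ G₂)))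
  have hrτ : r τ = t := by simp [r, τ, hF]
  -- Faithfulness of left translation of `G` on `G × H` gives the injectivity of `f`.
  have hrf : r.comp f = leftPerm G H := by
    refine hom_ext (MonoidHom.ext fun g => ?_) (MonoidHom.ext fun g => ?_)
    · have : r (f (inl g)) = ρ (g, 1) := by
        have h1 : f (inl g) = SemidirectProduct.inr (g, 1) := lift_apply_inl _ _ _
        rw [h1]
        exact SemidirectProduct.lift_inr ..
      refine this.trans (Equiv.ext fun x => ?_)
      rw [hρ, ← hθ₁, Equiv.symm_apply_apply]
      rfl
    · have : r (f (inr g)) = t * ρ (1, g) * t⁻¹ := by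
        have h1 : f (inr g) = τ * SemidirectProduct.inr (1, g) * τ⁻¹ := lift_apply_inr _ _ _
        rw [h1, map_mul, map_mul, map_inv, hrτ]
        simp [r]
      refine this.trans (Equiv.ext fun x => ?_)
      change θ₂.symm (θ₁ (ρ (1, g) (θ₁.symm (θ₂ x)))) = leftPerm G H (inr g) x
      rw [hρ, Equiv.apply_symm_apply, Equiv.apply_symm_apply, ← hθ₂, Equiv.symm_apply_apply]
  refine ⟨f, fun x y hxy => ?_⟩
  have h : x * 1 = y * 1 := congrArg (fun p : Equiv.Perm (G × H) => (p (1, 1)).1)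
    ((DFunLike.congr_fun hrf x).symm.trans ((congrArg r hxy).trans (DFunLike.congr_fun hrf y)))
  rwa [mul_one, mul_one] at h

end FreeProduct

/-! ### Common suffixes and cancellation in free groups -/

section CommonSuffix

variable {β : Type*} [DecidableEq β]

/-- The length of the longest common suffix of two lists. -/
def commonSuffix (B : List β) : List β → ℕ
  | [] => 0
  | a :: L => if (a :: L) <:+ B then L.length + 1 else commonSuffix B L

theorem commonSuffix_of_suffix {B L : List β} (h : L <:+ B) : commonSuffix B L = L.length := by
  cases L with
  | nil => rfl
  | cons a L => rw [commonSuffix, if_pos h, List.length_cons]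

/-- Maximality of the common suffix `K` is expressed by the last letters of the remaining parts
being different. -/
theorem exists_commonSuffix (B L : List β) : ∃ B' L' K : List β, B = B' ++ K ∧ L = L' ++ K ∧
    K.length = commonSuffix B L ∧ ∀ b ∈ B'.getLast?, ∀ a ∈ L'.getLast?, b ≠ a := by
  induction L with
  | nil => exact ⟨B, [], [], by simp, by simp, rfl, by simp⟩
  | cons a L ih =>
    by_cases h : (a :: L) <:+ B
    · obtain ⟨B', hB'⟩ := h
      exact ⟨B', [], a :: L, hB'.symm, rfl, by rw [commonSuffix, if_pos ⟨B', hB'⟩]; rfl, by simp⟩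
    · obtain ⟨B', L', K, hB, hL, hK, hne⟩ := ih
      refine ⟨B', a :: L', K, hB, by rw [hL, List.cons_append], by rw [commonSuffix, if_neg h, hK],
        ?_⟩
      intro b hb a' ha'
      rcases L' with _ | ⟨c, L'⟩
      · rintro rfl
        simp only [List.getLast?_singleton, Option.mem_some_iff] at ha'
        subst ha'
        rw [Option.mem_def, List.getLast?_eq_some_iff] at hb
        obtain ⟨B'', rfl⟩ := hb
        exact h ⟨B'', by rw [hB, hL]; simp⟩
      · exact hne b hb a' (by simpa [List.getLast?_cons_cons] using ha')

/-- The common suffix cancels, and nothing else does because the parts left over end in different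
letters. -/
theorem norm_mk_mul_mk_inv {S : Type*} [DecidableEq S] {B L : List (S × Bool)}
    (hB : FreeGroup.IsReduced B) (hL : FreeGroup.IsReduced L) :
    (FreeGroup.mk B * (FreeGroup.mk L)⁻¹).norm + 2 * commonSuffix B L = B.length + L.length := by
  obtain ⟨B', L', K, hB', hL', hK, hne⟩ := exists_commonSuffix B L
  have hBr : FreeGroup.IsReduced B' := hB.infix ⟨[], K, by simp [hB']⟩
  have hLr : FreeGroup.IsReduced L' := hL.infix ⟨[], K, by simp [hL']⟩
  have hinv : FreeGroup.IsReduced (FreeGroup.invRev L') := by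
    rw [FreeGroup.isReduced_iff_reduce_eq, FreeGroup.reduce_invRev, hLr.reduce_eq]
  have hred : FreeGroup.IsReduced (B' ++ FreeGroup.invRev L') := by
    refine List.isChain_append.2 ⟨hBr, hinv, fun x hx y hy hxy => ?_⟩
    simp only [FreeGroup.invRev, List.head?_reverse, List.getLast?_map, Option.mem_def,
      Option.map_eq_some_iff] at hy
    obtain ⟨l, hl, rfl⟩ := hy
    have h := hne x hx l hl
    by_contra h2
    refine h (Prod.ext hxy ?_)
    simpa using h2
  have hmk : FreeGroup.mk B * (FreeGroup.mk L)⁻¹ = FreeGroup.mk (B' ++ FreeGroup.invRev L') := by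
    rw [hB', hL', ← FreeGroup.mul_mk, ← FreeGroup.mul_mk, ← FreeGroup.mul_mk, ← FreeGroup.inv_mk]
    group
  rw [hmk, FreeGroup.norm, FreeGroup.toWord_mk, hred.reduce_eq, ← hK, hB', hL']
  simp only [List.length_append, FreeGroup.invRev_length]
  omega

end CommonSuffix

/-! ### Vectors and operators on `ℓ²` of the tree of lists -/

section Tree

variable {β : Type u} [DecidableEq β]

/-- The standard basis vectors of `ℓ²` over the tree of lists. -/
noncomputable def listBasis (L : List β) : lp (fun _ : List β => ℂ) 2 := lp.single 2 L 1

theorem norm_listBasis (L : List β) : ‖listBasis L‖ = 1 := by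
  rw [listBasis, lp.norm_single (by norm_num), norm_one]

theorem inner_listBasis (L : List β) (f : lp (fun _ : List β => ℂ) 2) :
    inner ℂ (listBasis L) f = f L := by
  rw [listBasis, lp.inner_single_left]
  simp

/-- The vector `∑ r ^ k e_{L_k}` over the suffixes `L_k` of `L`, where `L_k` is `L` without its
first `k` letters. -/
noncomputable def suffixVec (r : ℝ) : List β → lp (fun _ : List β => ℂ) 2
  | [] => listBasis []
  | a :: L => listBasis (a :: L) + (r : ℂ) • suffixVec r L

/-- The vectors with Gram matrix `r ^ dist` on the tree of lists. -/
noncomputable def treeVec (r : ℝ) : List β → lp (fun _ : List β => ℂ) 2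
  | [] => listBasis []
  | a :: L => ((√(1 - r ^ 2) : ℝ) : ℂ) • listBasis (a :: L) + (r : ℂ) • treeVec r L

theorem inner_listBasis_listBasis (L K : List β) :
    (inner ℂ (listBasis L) (listBasis K) : ℂ) = if L = K then 1 else 0 := by
  rw [inner_listBasis, listBasis, lp.single_apply, Pi.single_apply]

theorem inner_nil_treeVec (r : ℝ) (B : List β) :
    inner ℂ (listBasis []) (treeVec r B) = (r : ℂ) ^ B.length := by
  induction B with
  | nil => rw [treeVec, inner_listBasis_listBasis]; simp
  | cons b B ih =>
    simp only [treeVec, inner_add_right, inner_smul_right, ih, inner_listBasis_listBasis]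
    simp [pow_succ']

theorem inner_cons_treeVec (r : ℝ) (a : β) (L B : List β) :
    inner ℂ (listBasis (a :: L)) (treeVec r B) = if (a :: L) <:+ B then
      ((√(1 - r ^ 2) : ℝ) : ℂ) * (r : ℂ) ^ (B.length - (L.length + 1)) else 0 := by
  induction B with
  | nil => simp [treeVec, inner_listBasis_listBasis]
  | cons b B ih =>
    simp only [treeVec, inner_add_right, inner_smul_right, ih, inner_listBasis_listBasis,
      List.suffix_cons_iff]
    by_cases h : a :: L = b :: B
    · have h2 : ¬ (a :: L) <:+ B := fun h' => by
        have := h'.length_le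
        rw [h] at this
        simp at this
      have h3 : L.length = B.length := by
        have := congrArg List.length h
        simpa using this
      simp only [if_pos h, if_neg h2, if_pos (Or.inl h), List.length_cons, h3]
      simp
    · simp only [h, false_or, if_false]
      split_ifs with h2
      · have h3 := h2.length_le
        rw [List.length_cons] at h3
        have h4 : (b :: B).length - (L.length + 1) = B.length - (L.length + 1) + 1 := by
          rw [List.length_cons]; omega
        rw [h4, pow_succ]
        ring
      · simp

theorem commonSuffix_le (B L : List β) :
    commonSuffix B L ≤ B.length ∧ commonSuffix B L ≤ L.length := by
  obtain ⟨B', L', K, hB, hL, hK, -⟩ := exists_commonSuffix B L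
  rw [← hK, hB, hL]
  simp

/-- The exponent is the distance in the tree. Adding a letter to `L` multiplies by `r` when `L`
leaves the path to `B`; on the path, `(1 - r ^ 2) * r ^ k + r * r ^ (k + 1) = r ^ k`. -/
theorem inner_treeVec {r : ℝ} (hr : r ^ 2 ≤ 1) (B L : List β) :
    inner ℂ (treeVec r L) (treeVec r B) =
      (r : ℂ) ^ (B.length + L.length - 2 * commonSuffix B L) := by
  have hc : ((√(1 - r ^ 2) : ℝ) : ℂ) * ((√(1 - r ^ 2) : ℝ) : ℂ) = 1 - (r : ℂ) ^ 2 := by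
    rw [← Complex.ofReal_mul, Real.mul_self_sqrt (by linarith)]
    push_cast; rfl
  induction L with
  | nil => simp [treeVec, inner_nil_treeVec, commonSuffix]
  | cons a L ih =>
    have hle := commonSuffix_le B L
    rw [treeVec, inner_add_left, inner_smul_left, inner_smul_left, ih, inner_cons_treeVec,
      Complex.conj_ofReal, Complex.conj_ofReal, commonSuffix]
    by_cases h : (a :: L) <:+ B
    · have hl := h.length_le
      rw [List.length_cons] at hl
      rw [if_pos h, if_pos h, commonSuffix_of_suffix ((List.suffix_cons a L).trans h)]
      obtain ⟨k, hk⟩ : ∃ k, B.length = L.length + 1 + k := ⟨_, (Nat.add_sub_of_le hl).symm⟩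
      have e1 : B.length - (L.length + 1) = k := by omega
      have e2 : B.length + L.length - 2 * L.length = k + 1 := by omega
      have e3 : B.length + (a :: L).length - 2 * (L.length + 1) = k := by
        rw [List.length_cons]; omega
      rw [e1, e2, e3, ← mul_assoc, hc]
      ring
    · rw [if_neg h, if_neg h, mul_zero, zero_add, ← pow_succ']
      congr 1
      rw [List.length_cons]
      omega

theorem exists_diagonal (w : List β → ℂ) (M : ℝ) (hw : ∀ L, ‖w L‖ ≤ M) :
    ∃ T : lp (fun _ : List β => ℂ) 2 →L[ℂ] lp (fun _ : List β => ℂ) 2,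
      ‖T‖ ≤ M ∧ ∀ L, T (listBasis L) = w L • listBasis L := by
  obtain ⟨T, hT, hT'⟩ := exists_weighted_partial_perm (fun L : List β => L)
    (fun L => w L • ContinuousLinearMap.id ℂ ℂ) M ((norm_nonneg _).trans (hw []))
    (fun L => by simpa [norm_smul] using hw L) fun _ _ _ _ h => h
  refine ⟨T, hT, fun L => ?_⟩
  ext K
  rw [hT']
  simp only [listBasis, lp.coeFn_smul, Pi.smul_apply, lp.single_apply, Pi.single_apply]
  split_ifs with h
  · subst h; simp
  · simp

/-- The weighted shift along the path of suffixes of `B`. -/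
theorem exists_pathShift (B : List β) (w : List β → ℂ) (M : ℝ) (hw : ∀ L, ‖w L‖ ≤ M) :
    ∃ T : lp (fun _ : List β => ℂ) 2 →L[ℂ] lp (fun _ : List β => ℂ) 2,
      ‖T‖ ≤ M ∧ T (listBasis []) = 0 ∧
        ∀ a L, T (listBasis (a :: L)) = if (a :: L) <:+ B then w L • listBasis L else 0 := by
  classical
  -- `σ L` is the child of `L` on the path to `B`, if there is one; it is unique because suffixes of
  -- `B` are determined by their length.
  let σ : List β → List β := fun L => if h : ∃ a, (a :: L) <:+ B then h.choose :: L else L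
  let A : List β → (ℂ →L[ℂ] ℂ) := fun L =>
    if ∃ a, (a :: L) <:+ B then w L • ContinuousLinearMap.id ℂ ℂ else 0
  have hM : 0 ≤ M := (norm_nonneg _).trans (hw [])
  have hA : ∀ L, A L ≠ 0 → ∃ a, (a :: L) <:+ B := fun L h => by
    by_contra h'
    exact h (if_neg h')
  obtain ⟨T, hT, hT'⟩ := exists_weighted_partial_perm σ A M hM
    (fun L => by
      simp only [A]
      split_ifs
      · simpa [norm_smul] using hw L
      · simpa using hM)
    (fun L K hL hK h => by
      simp only [σ, dif_pos (hA L hL), dif_pos (hA K hK)] at h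
      exact (List.cons_eq_cons.1 h).2)
  have huniq : ∀ a b L, (a :: L) <:+ B → (b :: L) <:+ B → a = b := fun a b L h h' => by
    have := List.suffix_of_suffix_length_le h h' (by simp)
    have := this.eq_of_length (by simp)
    exact (List.cons_eq_cons.1 this).1
  refine ⟨T, hT, ?_, fun a L => ?_⟩
  · ext K
    rw [hT']
    simp only [A]
    split_ifs with h
    · simp [σ, dif_pos h, listBasis, lp.single_apply]
    · simp
  · ext K
    rw [hT']
    simp only [A]
    by_cases hK : ∃ b, (b :: K) <:+ B
    · have hσ : σ K = hK.choose :: K := dif_pos hK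
      rw [if_pos hK, hσ]
      by_cases hKL : K = L
      · subst hKL
        by_cases haK : (a :: K) <:+ B
        · have : hK.choose = a := huniq _ _ _ hK.choose_spec haK
          rw [if_pos haK, this]
          simp [listBasis]
        · have : hK.choose ≠ a := fun h => haK (h ▸ hK.choose_spec)
          rw [if_neg haK]
          simp [listBasis, lp.single_apply, this]
      · have h1 : hK.choose :: K ≠ a :: L := fun h => hKL (List.cons_eq_cons.1 h).2
        split_ifs <;> simp [listBasis, lp.single_apply, h1, hKL]
    · rw [if_neg hK]
      split_ifs with h
      · have hKL : K ≠ L := by rintro rfl; exact hK ⟨a, h⟩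
        simp [listBasis, lp.single_apply, Pi.single_apply, hKL]
      · simp

/-- Write `v_L` for `suffixVec r L`. Since `v_(a::L) = e_(a::L) + r v_L`, the operator must send
`e_(a::L)` to `b ^ commonSuffix B (a::L) e_(a::L)` plus `r` times the jump of `b ^ commonSuffix B`
from `L` to `a::L` times `v_L`. The jump vanishes off the path to `B`. On the path `v_L = (1 - r
Q)⁻¹ e_L`, with `Q` the shift towards the root. So `T = Δ + r (1 - r Q)⁻¹ P`, bounded independently
of `B` and `b`. -/
theorem exists_commonSuffix_multiplier_suffixVec {r : ℝ} (hr0 : 0 ≤ r)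
    (hr1 : r < 1) (B : List β) {b : ℂ} (hb : ‖b‖ = 1) :
    ∃ T : lp (fun _ : List β => ℂ) 2 →L[ℂ] lp (fun _ : List β => ℂ) 2,
      ‖T‖ ≤ 1 + r * ((1 - r)⁻¹ * 2) ∧
        ∀ L, T (suffixVec r L) = b ^ commonSuffix B L • suffixVec r L := by
  obtain ⟨Δ, hΔ, hΔ'⟩ := exists_diagonal (fun L => b ^ commonSuffix B L) 1 (by simp [hb])
  obtain ⟨Q, hQ, hQ0, hQ1⟩ := exists_pathShift B (fun _ => 1) 1 (by simp)
  obtain ⟨P, hP, hP0, hP1⟩ := exists_pathShift B (fun L => b ^ (L.length + 1) - b ^ L.length) 2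
    (fun L => (norm_sub_le _ _).trans (by simp only [norm_pow, hb, one_pow]; norm_num))
  have hrn : ‖(r : ℂ)‖ = r := by rw [Complex.norm_real, Real.norm_of_nonneg hr0]
  have hrQ : ‖(r : ℂ) • Q‖ < 1 := by
    rw [norm_smul, hrn]
    nlinarith [norm_nonneg Q]
  let U := Units.oneSub ((r : ℂ) • Q) hrQ
  let R : lp (fun _ : List β => ℂ) 2 →L[ℂ] lp (fun _ : List β => ℂ) 2 := ↑U⁻¹
  have hRU : ∀ f, R (f - (r : ℂ) • Q f) = f := fun f => DFunLike.congr_fun U.inv_mul f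
  have hUR : 1 = R - ((r : ℂ) • Q) * R := by
    have := U.mul_inv
    rw [Units.val_oneSub, sub_mul, one_mul] at this
    exact this.symm
  have hR : ‖R‖ ≤ (1 - r)⁻¹ := by
    have h1 : R = 1 + ((r : ℂ) • Q) * R := by rw [hUR]; abel
    have h2 : ‖R‖ ≤ 1 + r * ‖R‖ := by
      calc ‖R‖ = ‖1 + ((r : ℂ) • Q) * R‖ := by rw [← h1]
        _ ≤ ‖(1 : lp (fun _ : List β => ℂ) 2 →L[ℂ] lp (fun _ : List β => ℂ) 2)‖ +
            ‖((r : ℂ) • Q) * R‖ := norm_add_le _ _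
        _ ≤ 1 + r * ‖R‖ := by
          refine add_le_add ContinuousLinearMap.norm_id_le ((norm_mul_le _ _).trans ?_)
          refine mul_le_mul_of_nonneg_right ?_ (norm_nonneg _)
          rw [norm_smul, hrn]
          exact mul_le_of_le_one_right hr0 hQ
    rw [← one_div, le_div_iff₀ (by linarith)]
    linarith
  have hQs : ∀ a L, (a :: L) <:+ B → Q (suffixVec r (a :: L)) = suffixVec r L := by
    intro a L
    induction L generalizing a with
    | nil => intro h; simp [suffixVec, hQ0, hQ1, h]
    | cons c L ih =>
      intro h
      rw [suffixVec, map_add, map_smul, ih c ((List.suffix_cons _ _).trans h), hQ1, if_pos h,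
        one_smul, suffixVec]
  have hRs : ∀ L, L <:+ B → R (listBasis L) = suffixVec r L := by
    intro L hL
    rw [← hRU (suffixVec r L)]
    congr 1
    cases L with
    | nil => simp [suffixVec, hQ0]
    | cons a L => rw [hQs a L hL, suffixVec, add_sub_cancel_right]
  have hsum : ∀ f, (Δ + (r : ℂ) • (R ∘L P)) f = Δ f + (r : ℂ) • R (P f) := fun f => rfl
  refine ⟨Δ + (r : ℂ) • (R ∘L P), ?_, fun L => ?_⟩
  · refine (norm_add_le _ _).trans (add_le_add hΔ ?_)
    rw [norm_smul, hrn]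
    refine mul_le_mul_of_nonneg_left ((ContinuousLinearMap.opNorm_comp_le _ _).trans ?_) hr0
    exact mul_le_mul hR hP (norm_nonneg _) ((norm_nonneg _).trans hR)
  · induction L with
    | nil => rw [suffixVec, hsum, hP0, hΔ', map_zero, smul_zero, add_zero]
    | cons a L ih =>
      rw [suffixVec, map_add, map_smul, ih]
      simp only [hsum, hP1, hΔ']
      by_cases h : (a :: L) <:+ B
      · have hL := (List.suffix_cons a L).trans h
        rw [if_pos h, map_smul, hRs L hL, commonSuffix_of_suffix h, commonSuffix_of_suffix hL,
          List.length_cons]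
        module
      · rw [if_neg h, map_zero, smul_zero, add_zero, commonSuffix, if_neg h]
        module

/-- The two families of vectors differ by an invertible diagonal operator, `1` at the root and `√(1
- r ^ 2)` elsewhere; conjugating by it costs a constant. -/
theorem exists_commonSuffix_multiplier {r : ℝ} (hr0 : 0 ≤ r) (hr1 : r < 1) :
    ∃ C : ℝ, 0 ≤ C ∧ ∀ (B : List β) (b : ℂ), ‖b‖ = 1 →
      ∃ T : lp (fun _ : List β => ℂ) 2 →L[ℂ] lp (fun _ : List β => ℂ) 2,
        ‖T‖ ≤ C ∧ ∀ L, T (treeVec r L) = b ^ commonSuffix B L • treeVec r L := by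
  set c := √(1 - r ^ 2) with hc
  have hr2 : r ^ 2 < 1 := by nlinarith
  have hc0 : 0 < c := Real.sqrt_pos.2 (by linarith)
  have hc1 : c ≤ 1 := Real.sqrt_le_one.2 (by nlinarith)
  have hc0' : (c : ℂ) ≠ 0 := by exact_mod_cast hc0.ne'
  have hcn : ‖(c : ℂ)‖ = c := by rw [Complex.norm_real, Real.norm_of_nonneg hc0.le]
  obtain ⟨D, hD, hD'⟩ := exists_diagonal (fun L : List β => if L = [] then 1 else (c : ℂ)) 1
    (fun L => by
      split_ifs
      · simp
      · rwa [hcn])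
  obtain ⟨E, hE, hE'⟩ := exists_diagonal (fun L : List β => if L = [] then 1 else (c : ℂ)⁻¹) c⁻¹
    (fun L => by
      split_ifs
      · simpa using (one_le_inv₀ hc0).2 hc1
      · simp [abs_of_pos hc0])
  have hDs : ∀ L, D (suffixVec r L) = treeVec r L := by
    intro L
    induction L with
    | nil => simp [suffixVec, treeVec, hD']
    | cons a L ih => rw [suffixVec, treeVec, map_add, map_smul, ih, hD', if_neg (by simp)]
  have hEt : ∀ L, E (treeVec r L) = suffixVec r L := by
    intro L
    induction L with
    | nil => simp [suffixVec, treeVec, hE']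
    | cons a L ih =>
      rw [suffixVec, treeVec, map_add, map_smul, map_smul, ih, hE', if_neg (by simp), ← hc,
        smul_smul, mul_inv_cancel₀ hc0', one_smul]
  have hpos : 0 ≤ 1 + r * ((1 - r)⁻¹ * 2) := by
    have : 0 ≤ (1 - r)⁻¹ := inv_nonneg.2 (by linarith)
    positivity
  refine ⟨1 * ((1 + r * ((1 - r)⁻¹ * 2)) * c⁻¹), by positivity, fun B b hb => ?_⟩
  obtain ⟨T, hT, hT'⟩ := exists_commonSuffix_multiplier_suffixVec hr0 hr1 B hb
  refine ⟨D ∘L T ∘L E, ?_, fun L => ?_⟩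
  · refine (ContinuousLinearMap.opNorm_comp_le _ _).trans ?_
    refine mul_le_mul hD ?_ (norm_nonneg _) zero_le_one
    refine (ContinuousLinearMap.opNorm_comp_le _ _).trans ?_
    exact mul_le_mul hT hE (norm_nonneg _) hpos
  · simp only [ContinuousLinearMap.comp_apply, hEt, hT', map_smul, hDs]

end Tree

/-! ### Powers of the word length as multipliers of free groups -/

section FreeGroup

variable {S : Type u} [DecidableEq S] {d : ℕ}

theorem norm_mul_add_commonSuffix (x y : FreeGroup S) :
    (x * y).norm + 2 * commonSuffix x.toWord y⁻¹.toWord = x.norm + y.norm := by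
  have h := norm_mk_mul_mk_inv (FreeGroup.isReduced_toWord (x := x))
    (FreeGroup.isReduced_toWord (x := y⁻¹))
  rw [FreeGroup.mk_toWord, FreeGroup.mk_toWord, inv_inv] at h
  rw [h]
  change _ = x.norm + y.norm
  rw [← FreeGroup.norm_inv_eq (x := y)]
  rfl

/-- Inverting the words turns common prefixes into common suffixes, so the tree distance becomes the
left-invariant word metric. -/
theorem inner_treeVec_toWord {r : ℝ} (hr : r ^ 2 ≤ 1) (x y : FreeGroup S) :
    inner ℂ (treeVec r x⁻¹.toWord) (treeVec r y⁻¹.toWord) = (r : ℂ) ^ (x⁻¹ * y).norm := by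
  rw [inner_treeVec hr]
  congr 1
  have h := norm_mul_add_commonSuffix y⁻¹ x
  have h2 : (y⁻¹ * x).norm = (x⁻¹ * y).norm := by
    rw [← FreeGroup.norm_inv_eq]; congr 1; group
  have h3 : x⁻¹.toWord.length = x.norm := FreeGroup.norm_inv_eq (x := x)
  have h4 : y⁻¹.toWord.length = y⁻¹.norm := rfl
  rw [h3, h4]
  omega

theorem norm_treeVec_one (r : ℝ) :
    ‖treeVec r (1 : FreeGroup S)⁻¹.toWord‖ = 1 := by
  simp [treeVec, norm_listBasis]

theorem inner_nil_treeVec_toWord (r : ℝ) (x : FreeGroup S) :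
    inner ℂ (listBasis []) (treeVec r x⁻¹.toWord) = (r : ℂ) ^ x.norm := by
  rw [inner_nil_treeVec]
  congr 1
  exact FreeGroup.norm_inv_eq (x := x)

theorem inner_treeVec_translate {r : ℝ} (hr : r ^ 2 ≤ 1) (g x y : FreeGroup S) :
    (inner ℂ (treeVec r (g * x)⁻¹.toWord) (treeVec r (g * y)⁻¹.toWord) : ℂ) =
      inner ℂ (treeVec r x⁻¹.toWord) (treeVec r y⁻¹.toWord) := by
  rw [inner_treeVec_toWord hr, inner_treeVec_toWord hr]
  congr 2
  group

theorem exists_decomposition_pow_norm (hd : d ≠ 0) {r : ℝ} (hr : r ^ 2 ≤ 1) :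
    ∃ D : Decomposition d (fun x : FreeGroup S => (r : ℂ) ^ x.norm), D.cost ≤ 1 := by
  have h := exists_decomposition_of_invariant hd
    (fun x : FreeGroup S => treeVec r x⁻¹.toWord) (listBasis []) (inner_treeVec_translate hr)
  rwa [funext fun x => inner_nil_treeVec_toWord r x, norm_listBasis, norm_treeVec_one,
    one_mul] at h

/-- `z ^ |x|` is a coefficient of a uniformly bounded representation for `|z| < 1`. -/
theorem exists_decomposition_complex_pow_norm (hd : d ≠ 0) {r : ℝ} (hr0 : 0 ≤ r) (hr1 : r < 1) :
    ∃ C : ℝ, ∀ ζ : ℂ, ‖ζ‖ = 1 →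
      ∃ D : Decomposition d (fun x : FreeGroup S => ((r : ℂ) * ζ) ^ x.norm), D.cost ≤ C := by
  obtain ⟨C, hC0, hC⟩ := exists_commonSuffix_multiplier (β := S × Bool) hr0 hr1
  have hr : r ^ 2 ≤ 1 := by nlinarith
  refine ⟨C ^ d, fun ζ hζ => ?_⟩
  have hζ0 : ζ ≠ 0 := norm_ne_zero_iff.1 (by rw [hζ]; exact one_ne_zero)
  let v : FreeGroup S → lp (fun _ : List (S × Bool) => ℂ) 2 := fun x => treeVec r x⁻¹.toWord
  have hv : ∀ (g : FreeGroup S) (f : FreeGroup S →₀ ℂ),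
      ‖f.sum fun x a => a • (ζ ^ (g * x).norm • v (g * x))‖ ≤
        C * ‖f.sum fun x a => a • (ζ ^ x.norm • v x)‖ := by
    intro g f
    -- By `|g x| = |g| + |x| - 2 commonSuffix`, translation by `g` changes `ζ ^ |x|` by the
    -- unimodular constant `ζ ^ |g|` and by `b ^ commonSuffix` with `b = ζ⁻¹ ^ 2`, while translating
    -- the vectors `v` is isometric.
    obtain ⟨T, hT, hT'⟩ := hC g.toWord (ζ⁻¹ ^ 2) (by simp [hζ])
    have hpow : ∀ x : FreeGroup S, ζ ^ (g * x).norm =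
        ζ ^ g.norm * (ζ ^ x.norm * (ζ⁻¹ ^ 2) ^ commonSuffix g.toWord x⁻¹.toWord) := fun x => by
      rw [← mul_assoc, ← pow_add, ← norm_mul_add_commonSuffix g x, pow_add, ← pow_mul, inv_pow,
        mul_inv_cancel_right₀ (pow_ne_zero _ hζ0)]
    have h1 : (f.sum fun x a => a • (ζ ^ (g * x).norm • v (g * x))) =
        ∑ x ∈ f.support, (f x * ζ ^ (g * x).norm) • v (g * x) :=
      Finset.sum_congr rfl fun x _ => smul_smul _ _ _
    have h2 : ∑ x ∈ f.support, (f x * ζ ^ (g * x).norm) • v x =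
        ζ ^ g.norm • T (f.sum fun x a => a • (ζ ^ x.norm • v x)) := by
      rw [Finsupp.sum, map_sum, Finset.smul_sum]
      refine Finset.sum_congr rfl fun x _ => ?_
      rw [map_smul, map_smul, hT', hpow]
      simp only [smul_smul]
      congr 1
      ring
    rw [h1, norm_sum_smul_translate_eq v (inner_treeVec_translate hr), h2, norm_smul, norm_pow, hζ,
      one_pow, one_mul]
    exact (T.le_opNorm _).trans (mul_le_mul_of_nonneg_right hT (norm_nonneg _))
  have key := exists_decomposition_of_bounded_translation hd
    (fun x => ζ ^ x.norm • v x) (listBasis []) C hC0 hv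
  have h : (fun x : FreeGroup S => inner ℂ (listBasis []) (ζ ^ x.norm • v x)) =
      fun x => ((r : ℂ) * ζ) ^ x.norm := by
    funext x
    rw [inner_smul_right, inner_nil_treeVec_toWord, mul_pow, mul_comm]
  rwa [h, norm_listBasis, norm_smul, norm_pow, hζ, norm_treeVec_one, one_pow, one_mul, one_mul,
    one_mul] at key

theorem finite_setOf_norm_lt [Finite S] (M : ℕ) : {x : FreeGroup S | x.norm < M}.Finite :=
  Set.Finite.of_finite_image ((List.finite_length_lt (S × Bool) M).subset (by
    rintro _ ⟨x, hx, rfl⟩; exact hx)) FreeGroup.toWord_injective.injOn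

end FreeGroup

/-! ### Fourier coefficient bound -/

section Fourier

/-- Integrating the series against `e ^ (-i j θ)` over the circle isolates `a j`. -/
theorem norm_le_of_circle_bound {a : ℕ → ℂ} (ha : Summable fun m => ‖a m‖) {K : ℝ}
    (hK : ∀ ζ : ℂ, ‖ζ‖ = 1 → ‖∑' m, a m * ζ ^ m‖ ≤ K) (j : ℕ) : ‖a j‖ ≤ K := by
  let F : ℕ → C(ℝ, ℂ) := fun m =>
    ⟨fun θ => a m * Complex.exp (((m : ℤ) - j : ℤ) * Complex.I * θ), by fun_prop⟩
  have hF : ∀ m θ, ‖F m θ‖ = ‖a m‖ := fun m θ => by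
    have : ((((m : ℤ) - j : ℤ) : ℂ) * Complex.I * θ) =
        ((((m : ℤ) - j : ℤ) * θ : ℝ) : ℂ) * Complex.I := by
      push_cast; ring
    change ‖a m * Complex.exp _‖ = _
    rw [this, norm_mul, Complex.norm_exp_ofReal_mul_I, mul_one]
  have hsum := intervalIntegral.hasSum_intervalIntegral_of_summable_norm (a := 0)
    (b := 2 * Real.pi) (f := F) (ha.of_nonneg_of_le (fun _ => norm_nonneg _) fun m =>
      (ContinuousMap.norm_le _ (norm_nonneg _)).2 fun θ => (hF m θ).le)
  have hint : ∀ m, ∫ θ in (0 : ℝ)..2 * Real.pi, F m θ = if m = j then 2 * Real.pi * a j else 0 := by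
    intro m
    change ∫ θ in (0 : ℝ)..2 * Real.pi, a m * Complex.exp _ = _
    rw [intervalIntegral.integral_const_mul]
    split_ifs with h
    · subst h
      simp [mul_comm]
    · have hc : ((((m : ℤ) - j : ℤ) : ℂ) * Complex.I) ≠ 0 :=
        mul_ne_zero (Int.cast_ne_zero.2 (sub_ne_zero.2 (by exact_mod_cast h))) Complex.I_ne_zero
      have h1 : (((m : ℤ) - j : ℤ) : ℂ) * Complex.I * ((2 * Real.pi : ℝ) : ℂ) =
          (((m : ℤ) - j : ℤ) : ℂ) * (2 * Real.pi * Complex.I) := by push_cast; ring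
      rw [integral_exp_mul_complex hc, h1, Complex.exp_int_mul_two_pi_mul_I]
      simp
  simp only [hint] at hsum
  have htot := hsum.unique (hasSum_ite_eq j _)
  have hbound : ‖∫ θ in (0 : ℝ)..2 * Real.pi, ∑' m, F m θ‖ ≤ K * |2 * Real.pi - 0| := by
    refine intervalIntegral.norm_integral_le_of_norm_le_const fun θ _ => ?_
    have h1 : ∀ m, F m θ = a m * Complex.exp (θ * Complex.I) ^ m *
        Complex.exp (-(j * θ : ℝ) * Complex.I) := fun m => by
      change a m * Complex.exp _ = _
      rw [mul_assoc (a m), ← Complex.exp_nat_mul, ← Complex.exp_add]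
      congr 2
      push_cast
      ring
    rw [tsum_congr h1, tsum_mul_right, norm_mul, ← Complex.ofReal_neg,
      Complex.norm_exp_ofReal_mul_I, mul_one]
    exact hK _ (Complex.norm_exp_ofReal_mul_I θ)
  have hpi : (0 : ℝ) < 2 * Real.pi := by positivity
  rw [htot, sub_zero, abs_of_pos hpi, norm_mul] at hbound
  have h2 : ‖(2 * Real.pi : ℂ)‖ = 2 * Real.pi := by
    rw [← Complex.ofReal_ofNat, ← Complex.ofReal_mul, Complex.norm_real, Real.norm_of_nonneg hpi.le]
  rw [h2, mul_comm] at hbound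
  exact le_of_mul_le_mul_right hbound hpi

end Fourier

/-! ### Truncation of powers of a length function -/

section Length

variable {G : Type u} [Group G] {d : ℕ}

theorem hasSum_fiber_length {G : Type u} (ℓ : G → ℕ) (y : Ell1 G) (h : ℕ → ℂ) {B : ℝ}
    (hB : ∀ m, ‖h m‖ ≤ B) :
    HasSum (fun m => h m * ∑' g : ℓ ⁻¹' {m}, y g) (∑' g, h (ℓ g) * y g) := by
  have h1 := (summable_pairing (φ := fun g => h (ℓ g)) ⟨B, fun g => hB _⟩ y).hasSum.tsum_fiberwise ℓ
  have h2 : (fun m => h m * ∑' g : ℓ ⁻¹' {m}, y g) =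
      fun m => ∑' g : ℓ ⁻¹' {m}, h (ℓ g) * y g := funext fun m => by
    rw [← tsum_mul_left]
    refine tsum_congr fun g => ?_
    have hg : ℓ g = m := g.2
    rw [hg]
  rw [h2]
  exact h1

theorem summable_norm_fiber {G : Type u} (ℓ : G → ℕ) (y : Ell1 G) :
    Summable fun m => ‖∑' g : ℓ ⁻¹' {m}, y g‖ := by
  have hy : Summable fun t => ‖y t‖ := by
    simpa using (lp.memℓp y).summable (by norm_num)
  refine (hy.hasSum.tsum_fiberwise ℓ).summable.of_nonneg_of_le (fun _ => norm_nonneg _) fun m => ?_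
  exact norm_tsum_le_tsum_norm (hy.subtype _)

theorem norm_xdPairing_le_of_pairing_le (hd : d ≠ 0) (φ ψ : Md G d) (ε : ℝ)
    (h : ∀ y, ‖pairing φ y - pairing ψ y‖ ≤ ε * xdSeminorm G d y) (x : Xd G d) :
    ‖xdPairing φ x - xdPairing ψ x‖ ≤ ε * ‖x‖ := by
  induction x using UniformSpace.Completion.induction_on with
  | hp =>
    exact isClosed_le ((continuous_xdPairing φ).sub (continuous_xdPairing ψ)).norm
      (continuous_const.mul continuous_norm)
  | ih y =>
    rw [xdPairing_coe' hd, xdPairing_coe' hd, UniformSpace.Completion.norm_coe]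
    exact h _

/-- Let `a m` be the sum of `y` over the sphere of radius `m`. The pairing of `y` with `(t ζ) ^ ℓ`
has Fourier coefficients `a m * t ^ m` in `ζ`, so these are bounded by `C` times the seminorm of
`y`. Of the three factors in `(t ^ 3) ^ m`, one is absorbed by this bound, one gives `t ^ M` for `m
≥ M`, and one makes the tail summable. -/
theorem norm_pairing_truncation_le (hd : d ≠ 0) (ℓ : G → ℕ) {t : ℝ} (ht0 : 0 ≤ t) (ht1 : t < 1)
    {C : ℝ} (hC : ∀ ζ : ℂ, ‖ζ‖ = 1 →
      ∃ D : Decomposition d (fun g => ((t : ℂ) * ζ) ^ ℓ g), D.cost ≤ C)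
    (M : ℕ) (φ ψ : Md G d) (hφ : ∀ g, φ.1 g = ((t ^ 3 : ℝ) : ℂ) ^ ℓ g)
    (hψ : ∀ g, ψ.1 g = if ℓ g < M then ((t ^ 3 : ℝ) : ℂ) ^ ℓ g else 0) (y : Ell1 G) :
    ‖pairing φ y - pairing ψ y‖ ≤ (C * (1 - t)⁻¹ * t ^ M) * xdSeminorm G d y := by
  set a : ℕ → ℂ := fun m => ∑' g : ℓ ⁻¹' {m}, y g with ha
  set Y := xdSeminorm G d y
  have hY : 0 ≤ Y := apply_nonneg _ _
  have htn : ‖(t : ℂ)‖ = t := by rw [Complex.norm_real, Real.norm_of_nonneg ht0]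
  have htn3 : ‖((t ^ 3 : ℝ) : ℂ)‖ = t ^ 3 := by
    rw [Complex.norm_real, Real.norm_of_nonneg (by positivity)]
  have ht3 : t ^ 3 ≤ 1 := pow_le_one₀ ht0 ht1.le
  have hcoef : ∀ m, ‖a m‖ * t ^ m ≤ C * Y := fun m => by
    have hs : Summable fun m => ‖a m * (t : ℂ) ^ m‖ := by
      refine (summable_norm_fiber ℓ y).of_nonneg_of_le (fun _ => norm_nonneg _) fun m => ?_
      rw [norm_mul, norm_pow, htn]
      exact mul_le_of_le_one_right (norm_nonneg _) (pow_le_one₀ ht0 ht1.le)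
    have h := norm_le_of_circle_bound hs (K := C * Y) (fun ζ hζ => ?_) m
    · rwa [norm_mul, norm_pow, htn] at h
    obtain ⟨D, hD⟩ := hC ζ hζ
    have h1 := norm_pairing_le hd ⟨_, .of_decomposition hd D⟩ y
    have h2 := (hasSum_fiber_length ℓ y (fun m => ((t : ℂ) * ζ) ^ m) (B := 1) fun m => by
      rw [norm_pow, norm_mul, htn, hζ, mul_one]; exact pow_le_one₀ ht0 ht1.le).tsum_eq
    have h3 : ∀ m, ((t : ℂ) * ζ) ^ m * ∑' g : ℓ ⁻¹' {m}, y g = a m * (t : ℂ) ^ m * ζ ^ m :=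
      fun m => by rw [mul_pow]; ring
    rw [tsum_congr h3] at h2
    rw [h2]
    exact h1.trans (mul_le_mul_of_nonneg_right ((mdNorm_le_cost D).trans hD) hY)
  have hCY : 0 ≤ C * Y := (by positivity : 0 ≤ ‖a 0‖ * t ^ 0).trans (hcoef 0)
  have e1 := hasSum_fiber_length ℓ y (fun m => ((t ^ 3 : ℝ) : ℂ) ^ m) (B := 1) fun m => by
    rw [norm_pow, htn3]; exact pow_le_one₀ (by positivity) ht3
  have e2 := hasSum_fiber_length ℓ y (fun m => if m < M then ((t ^ 3 : ℝ) : ℂ) ^ m else 0)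
    (B := 1) fun m => by
      split_ifs
      · rw [norm_pow, htn3]; exact pow_le_one₀ (by positivity) ht3
      · simp
  have p1 : pairing φ y = ∑' g, ((t ^ 3 : ℝ) : ℂ) ^ ℓ g * y g :=
    tsum_congr fun g => by rw [hφ]
  have p2 : pairing ψ y = ∑' g, (if ℓ g < M then ((t ^ 3 : ℝ) : ℂ) ^ ℓ g else 0) * y g :=
    tsum_congr fun g => by rw [hψ]
  rw [p1, p2, ← (e1.sub e2).tsum_eq]
  have hgeo := (hasSum_geometric_of_lt_one ht0 ht1).mul_left (C * Y * t ^ M)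
  refine (tsum_of_norm_bounded hgeo fun m => ?_).trans (by ring_nf; rfl)
  rw [← sub_mul, norm_mul]
  split_ifs with hm
  · rw [sub_self, norm_zero, zero_mul]
    positivity
  · rw [sub_zero, norm_pow, htn3]
    calc (t ^ 3) ^ m * ‖a m‖ = (‖a m‖ * t ^ m) * t ^ m * t ^ m := by ring
      _ ≤ C * Y * t ^ M * t ^ m := by
        have : t ^ m ≤ t ^ M := pow_le_pow_of_le_one ht0 ht1.le (not_lt.1 hm)
        exact mul_le_mul_of_nonneg_right (mul_le_mul (hcoef m) this (by positivity) hCY)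
          (by positivity)

/-- A criterion for the `M_d`-AP: a proper length function `ℓ` such that the functions `z ^ ℓ` are
multipliers for `|z| < 1`, with a uniform bound for real `z`. -/
theorem hasMdAP_of_length (hd : d ≠ 0) (ℓ : G → ℕ) (hfin : ∀ M, {g | ℓ g < M}.Finite)
    (hreal : ∀ r : ℝ, 0 ≤ r → r < 1 →
      ∃ D : Decomposition d (fun g => (r : ℂ) ^ ℓ g), D.cost ≤ 1)
    (hcomplex : ∀ r : ℝ, 0 ≤ r → r < 1 → ∃ C : ℝ, ∀ ζ : ℂ, ‖ζ‖ = 1 →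
      ∃ D : Decomposition d (fun g => ((r : ℂ) * ζ) ^ ℓ g), D.cost ≤ C) :
    HasMdAP G d := by
  rw [hasMdAP_iff hd]
  intro x hx
  -- Any sequence in `[0, 1)` tending to `1` would do; the multipliers used are `(t n ^ 3) ^ ℓ`, the
  -- cube being what the truncation estimate requires.
  let t : ℕ → ℝ := fun n => 1 - 1 / ((n : ℝ) + 1)
  have ht0 : ∀ n, 0 ≤ t n := fun n => by
    have : 1 / ((n : ℝ) + 1) ≤ 1 := by
      rw [div_le_one (by positivity)]; linarith [(Nat.cast_nonneg n : (0 : ℝ) ≤ n)]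
    simp only [t]; linarith
  have ht1 : ∀ n, t n < 1 := fun n => by
    have : 0 < 1 / ((n : ℝ) + 1) := by positivity
    simp only [t]; linarith
  have htlim : Filter.Tendsto t Filter.atTop (𝓝 1) := by
    have h := (tendsto_const_nhds (x := (1 : ℝ))).sub
      (tendsto_one_div_add_atTop_nhds_zero_nat (𝕜 := ℝ))
    rwa [sub_zero] at h
  choose D hD using fun n => hreal (t n ^ 3) (pow_nonneg (ht0 n) 3)
    (pow_lt_one₀ (ht0 n) (ht1 n) three_ne_zero)
  let φ : ℕ → Md G d := fun n => ⟨_, .of_decomposition hd (D n)⟩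
  have hzero : ∀ n, xdPairing (φ n) x = 0 := fun n => by
    obtain ⟨C, hC⟩ := hcomplex (t n) (ht0 n) (ht1 n)
    have hbound : ∀ M : ℕ, ‖xdPairing (φ n) x‖ ≤ (C * (1 - t n)⁻¹ * t n ^ M) * ‖x‖ := fun M => by
      let f : G → ℂ := fun g => if ℓ g < M then ((t n ^ 3 : ℝ) : ℂ) ^ ℓ g else 0
      have hf : (Function.support f).Finite := (hfin M).subset fun g hg => by
        by_contra h
        exact hg (if_neg h)
      have h := norm_xdPairing_le_of_pairing_le hd (φ n)
        ⟨f, isMultiplier_of_finite_support hd hf⟩ _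
        (norm_pairing_truncation_le hd ℓ (ht0 n) (ht1 n) hC M _ _ (fun _ => rfl) fun _ => rfl) x
      rwa [xdPairing_eq_zero_of_finite hd hx ⟨f, _⟩ hf, sub_zero] at h
    have hlim : Filter.Tendsto (fun M : ℕ => (C * (1 - t n)⁻¹ * t n ^ M) * ‖x‖) Filter.atTop
        (𝓝 ((C * (1 - t n)⁻¹ * 0) * ‖x‖)) :=
      ((tendsto_pow_atTop_nhds_zero_of_lt_one (ht0 n) (ht1 n)).const_mul _).mul_const _
    rw [mul_zero, zero_mul] at hlim
    exact norm_le_zero_iff.1 (ge_of_tendsto' hlim hbound)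
  refine tendsto_nhds_unique (tendsto_xdPairing (l := Filter.atTop) hd φ (Md.one G d) 1
    (fun n => (mdNorm_le_cost (D n)).trans (hD n)) (fun g => ?_) x)
    (tendsto_const_nhds.congr fun n => (hzero n).symm)
  have h3 : Filter.Tendsto (fun n => ((t n ^ 3 : ℝ) : ℂ) ^ ℓ g) Filter.atTop
      (𝓝 (((1 ^ 3 : ℝ) : ℂ) ^ ℓ g)) :=
    ((Complex.continuous_ofReal.tendsto _).comp (htlim.pow 3)).pow _
  rw [one_pow, Complex.ofReal_one, one_pow] at h3
  exact h3

end Length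

/-! ### Free groups and free products -/

section FreeGroupAP

variable {d : ℕ}

theorem hasMdAP_freeGroup_of_finite (hd : d ≠ 0) (S : Type u) [Finite S] :
    HasMdAP (FreeGroup S) d := by
  classical
  exact hasMdAP_of_length hd FreeGroup.norm finite_setOf_norm_lt
    (fun r h0 h1 => exists_decomposition_pow_norm hd (by nlinarith))
    fun r h0 h1 => exists_decomposition_complex_pow_norm hd h0 h1

/-- Free groups have the `M_d`-AP. -/
theorem hasMdAP_freeGroup (hd : d ≠ 0) (S : Type u) : HasMdAP (FreeGroup S) d := by
  classical
  let ι : ∀ F : Finset S, FreeGroup F →* FreeGroup S := fun F => FreeGroup.map Subtype.val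
  -- Killing the basis elements outside `F` is a retraction onto the subgroup generated by `F`, and
  -- a retraction is a coset section.
  let s : ∀ F : Finset S, FreeGroup S →* FreeGroup F := fun F =>
    FreeGroup.lift fun a => if h : a ∈ F then FreeGroup.of ⟨a, h⟩ else 1
  have hs : ∀ F x, s F (ι F x) = x := fun F x => by
    have : (s F).comp (ι F) = MonoidHom.id _ := FreeGroup.ext_hom _ _ fun a => by
      simp [s, ι]
    exact DFunLike.congr_fun this x
  let σ : ∀ F, CosetSection (ι F) := fun F =>
    { s := s F, map_one := map_one _, map_mul := fun n x => by rw [map_mul, hs] }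
  refine HasMdAP.of_directed hd (l := Filter.atTop)
    (fun F : Finset S => hasMdAP_freeGroup_of_finite hd F) σ fun g => ?_
  have hmem : ∀ a : S, ∀ᶠ F : Finset S in Filter.atTop, FreeGroup.of a ∈ (ι F).range := fun a => by
    filter_upwards [Filter.eventually_ge_atTop {a}] with F hF
    exact ⟨FreeGroup.of ⟨a, hF (Finset.mem_singleton_self a)⟩, by simp [ι]⟩
  change ∀ᶠ F in Filter.atTop, g ∈ (ι F).range
  induction g using FreeGroup.induction_on with
  | C1 => exact .of_forall fun F => one_mem _
  | of a => exact hmem a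
  | inv_of a _ => exact (hmem a).mono fun F h => inv_mem h
  | mul x y hx hy => filter_upwards [hx, hy] with F h h' using mul_mem h h'

theorem HasMdAP.coprod (hd : d ≠ 0) {G₁ G₂ : Type u} [Group G₁] [Group G₂] (h₁ : HasMdAP G₁ d)
    (h₂ : HasMdAP G₂ d) : HasMdAP (Monoid.Coprod G₁ G₂) d := by
  obtain ⟨f, hf⟩ := exists_coprod_embedding (G₁ := G₁) (G₂ := G₂)
  exact ((hasMdAP_freeGroup hd _).semidirectProduct hd (h₁.prod hd h₂) _).of_injective hd f hf

end FreeGroupAP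

end MdMult

theorem corollary1p3 (d : ℕ) (hd : 2 ≤ d) :
    (∀ (G₁ G₂ : Type u) [Group G₁] [Group G₂],
      MdMult.HasMdAP G₁ d → MdMult.HasMdAP G₂ d → MdMult.HasMdAP (G₁ × G₂) d) ∧
    (∀ (G₁ G₂ : Type u) [Group G₁] [Group G₂] (α : G₁ →* MulAut G₂),
      MdMult.HasMdAP G₁ d → MdMult.HasMdAP G₂ d → MdMult.HasMdAP (G₂ ⋊[α] G₁) d) ∧
    (∀ (G₁ G₂ : Type u) [Group G₁] [Group G₂],
      MdMult.HasMdAP G₁ d → MdMult.HasMdAP G₂ d → MdMult.HasMdAP (Monoid.Coprod G₁ G₂) d) := by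
  have hd0 : d ≠ 0 := by omega
  exact ⟨fun _ _ _ _ h₁ h₂ => h₁.prod hd0 h₂, fun _ _ _ _ α h₁ h₂ => h₂.semidirectProduct hd0 h₁ α,
    fun _ _ _ _ h₁ h₂ => h₁.coprod hd0 h₂⟩
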